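/- A *join semilattice-ordered semigroup* is an algebra $\mathcal A=\langle A,;,+\rangle$ such that $\langle A,;\rangle$ is a semigroup, $\langle A,+\rangle$ is a join-semilattice (ordered by $a\le b\iff a+b=b$), and $a;(b+c)=a;b+a;c$, $(a+b);c=a;c+b;c$. It is *representable* if there are a non-empty set $D$ and an injective map $a\mapsto a^R\subseteq D\times D$ on $A$ with $(a+b)^R=a^R\cup b^R$ and $(a;b)^R=\{(x,z):\exists y\,((x,y)\in a^R,\ (y,z)\in b^R)\}$. $\mathbf R(;,+)$ is the class of all $\{;,+\}$-structures that are isomorphic to such an algebra of binary relations. *The game $\mathcal G_n(\mathcal A)$.* A prenetwork is a directed graph, each edge $(x,y)$ of which has a label $l(x,y)$, an upward closed subset of $A$ (non-edges have the empty label). In round $0$, $\forall$ picks $a\not\le b$ in $\mathcal A$, and $\exists$ plays the prenetwork with two nodes $x_0,x_1$ and one edge $(x_0,x_1)$, labelled ${\uparrow}a$. In each of the following $n$ rounds $\forall$ makes one of these moves in the current prenetwork, and $\exists$ answers with an extended prenetwork (labels are always closed upwards, and missing nodes and edges are added): * composition: $\forall$ picks nodes $x,y,z$ and $c\in l(x,y)$,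 $d\in l(y,z)$; $\exists$ adds $c;d$ to $l(x,z)$; * witness: $\forall$ picks an edge $(x,y)$ and $d,e\in A$ such that $c\le d;e$ for some $c\in l(x,y)$; $\exists$ chooses an old or a fresh node $z$ and adds $d$ to $l(x,z)$ and $e$ to $l(z,y)$; * join: $\forall$ picks an edge $(x,y)$ and $c,d\in A$ with $c+d\in l(x,y)$; $\exists$ chooses whether to add $c$ or $d$ to $l(x,y)$. $\forall$ wins the play if $b\in l(x_0,x_1)$ in one of the prenetworks that are played; otherwise $\exists$ wins. *The sentences $\rho_n$.* For a finite network $\mathcal N$ whose labels are finite sets of $\{;,+\}$-terms, a term $v$, and $n<\omega$, put $\sigma_0(\mathcal N,v)=\bigwedge_{t\in l(x_0,x_1)}\neg(t\le v)$, and let $\sigma_{n+1}(\mathcal N,v)$ be the conjunction of * $\bigwedge_{t\in l(x,y),\,t'\in l(y,z)}\sigma_n(\mathcal N_1,v)$, * $\bigwedge_{t\in l(x,y)}\forall p\,\forall q\,\bigl(t\le p;q\to\bigvee_w\sigma_n(\mathcal N_2,v)\bigr)$, where $w$ runs over the nodes of $\mathcal N$ and one fresh node, * $\bigwedge_{t\in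 l(x,y)}\forall p\,\forall q\,\bigl(t\le p+q\to\sigma_n(\mathcal N_3,v)\vee\sigma_n(\mathcal N_4,v)\bigr)$, where $p,q$ are new variables and $\mathcal N_1,\dots,\mathcal N_4$ are $\mathcal N$ with, respectively, $t;t'$ added to $l(x,z)$; $p$ added to $l(x,w)$ and $q$ to $l(w,y)$; $p$ added to $l(x,y)$; $q$ added to $l(x,y)$. Let $\rho_n=\forall v_0\forall v_1\,\bigl(\neg(v_0\le v_1)\to\sigma_n(\mathcal N_{v_0},v_1)\bigr)$, where $\mathcal N_{v_0}$ has the two nodes $x_0,x_1$ and the single edge $(x_0,x_1)$, labelled $\{v_0\}$. *Pseudo-universal classes.* A class $\mathcal K$ of $\mathcal L$-structures is *pseudo-universal* if there are a two-sorted language $\mathcal L^s$ with sorts $\mathbf a,\mathbf r$, containing the symbols of $\mathcal L$ as $\mathbf a$-sorted symbols, and a theory $T$ in $\mathcal L^s$ such that $\mathcal K$ is the class of the $\mathcal L$-reducts, in sort $\mathbf a$, of the models of $T$; every function symbol of $\mathcal L^s$ outside $\mathcal L$ takes values in sort $\mathbf r$; and every sentence of $T$ is built from atomic and negated atomic formulas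 with $\vee,\wedge,\forall x^{\mathbf a},\forall x^{\mathbf r},\exists x^{\mathbf r}$. **Theorem 5.** Let $\mathcal A$ be a join semilattice-ordered semigroup. For every $n<\omega$, $\mathcal A\models\rho_n$ if and only if $\exists$ has a winning strategy in $\mathcal G_n(\mathcal A)$; and $\mathcal A$ is representable if and only if $\mathcal A\models\rho_n$ for all $n<\omega$. Moreover, the class $\mathbf R(;,+)$ is pseudo-universal, and it is axiomatised by a recursively enumerable set of universal first-order sentences. -/

import Mathlib

open FirstOrder

universe u

namespace RelRep

/-! ### Join semilattice-ordered semigroups and representations -/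

/-- A join semilattice-ordered semigroup: `a * b` is the product `a ; b` and `a ⊔ b` is the
join `a + b`.  The order is the one of the semilattice, so `a ≤ b ↔ a ⊔ b = b`. -/
class JoinSemilatticeOrderedSemigroup (A : Type u) extends Semigroup A, SemilatticeSup A where
  mul_sup' : ∀ a b c : A, a * (b ⊔ c) = a * b ⊔ a * c
  sup_mul' : ∀ a b c : A, (a ⊔ b) * c = a * c ⊔ b * c

/-- `R` represents the algebra `(A, comp, join)` by binary relations on `D`: it is one-to-one,
turns `join` into union and `comp` into relational composition. -/
structure IsRepresentation {A D : Type u} (comp join : A → A → A) (R : A → SetRel D D) :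
    Prop where
  injective : Function.Injective R
  map_join : ∀ a b, R (join a b) = R a ∪ R b
  map_comp : ∀ a b, R (comp a b) = (R a).comp (R b)

/-- The algebra `(A, comp, join)` has a representation over some non-empty base. -/
def HasRepresentation {A : Type u} (comp join : A → A → A) : Prop :=
  ∃ (D : Type u) (_ : Nonempty D) (R : A → SetRel D D), IsRepresentation comp join R

/-- Representability of a join semilattice-ordered semigroup. -/
def Representable (A : Type u) [JoinSemilatticeOrderedSemigroup A] : Prop :=
  HasRepresentation (fun a b : A => a * b) (fun a b : A => a ⊔ b)

/-! ### The first-order signature `{;, +}` -/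

/-- The function symbols: two binary ones. -/
inductive Func : ℕ → Type
  | comp : Func 2
  | join : Func 2

/-- The signature `{;, +}`. -/
def sig : FirstOrder.Language.{0, 0} := ⟨Func, fun _ => Empty⟩

/-- A join semilattice-ordered semigroup as a structure of the signature `{;, +}`. -/
instance (A : Type u) [JoinSemilatticeOrderedSemigroup A] : sig.Structure A where
  funMap {_} f := match f with
    | Func.comp => fun xs => xs 0 * xs 1
    | Func.join => fun xs => xs 0 ⊔ xs 1
  RelMap {_} r := nomatch r

/-- The interpretation of `;` in a structure. -/
def compOp {M : Type u} [sig.Structure M] (a b : M) : M :=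
  FirstOrder.Language.Structure.funMap (L := sig) (n := 2) Func.comp ![a, b]

/-- The interpretation of `+` in a structure. -/
def joinOp {M : Type u} [sig.Structure M] (a b : M) : M :=
  FirstOrder.Language.Structure.funMap (L := sig) (n := 2) Func.join ![a, b]

/-- The class `R(;,+)` of all `{;, +}`-structures that are isomorphic to an algebra of binary
relations with relational composition and union. -/
def RClass (M : Type u) [sig.Structure M] : Prop :=
  HasRepresentation (compOp (M := M)) (joinOp (M := M))

/-! ### Prenetworks and the representability game -/

/-- A prenetwork over `A`: a directed graph whose edges are labelled with upward closed subsets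
of `A`.  Nodes are natural numbers; pairs that are not edges carry the empty label. -/
structure Prenetwork (A : Type u) [LE A] where
  nodes : Set ℕ
  edges : Set (ℕ × ℕ)
  label : ℕ → ℕ → Set A
  edges_subset : ∀ x y, (x, y) ∈ edges → x ∈ nodes ∧ y ∈ nodes
  isUpperSet_label : ∀ x y, IsUpperSet (label x y)
  label_eq_empty : ∀ x y, (x, y) ∉ edges → label x y = ∅

namespace Prenetwork

variable {A : Type u} [Preorder A]

/-- The prenetwork with the two nodes `0`, `1` and the single edge `(0, 1)`, labelled with the
upper cone of `a`. -/
def initial (a : A) : Prenetwork A where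
  nodes := {0, 1}
  edges := {(0, 1)}
  label x y := {c | (x, y) = (0, 1) ∧ a ≤ c}
  edges_subset x y h := by
    obtain ⟨rfl, rfl⟩ := Prod.mk.inj (Set.mem_singleton_iff.1 h)
    simp
  isUpperSet_label _ _ _ _ hcd h := ⟨h.1, h.2.trans hcd⟩
  label_eq_empty x y h := by
    ext c
    simp only [Set.mem_ofPred_eq, Set.mem_empty_iff_false, iff_false]
    exact fun h' => h h'.1

/-- Extend the label of the pair `(x, y)` by `a` (and close it upwards), adding the nodes `x`,
`y` and the edge `(x, y)` if they are not yet there. -/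
def add (N : Prenetwork A) (x y : ℕ) (a : A) : Prenetwork A where
  nodes := N.nodes ∪ {x, y}
  edges := N.edges ∪ {(x, y)}
  label u v := (upperClosure (N.label u v ∪ {c | (u, v) = (x, y) ∧ c = a}) : Set A)
  edges_subset u v h := by
    rcases h with h | h
    · exact ⟨Or.inl (N.edges_subset u v h).1, Or.inl (N.edges_subset u v h).2⟩
    · obtain ⟨rfl, rfl⟩ := Prod.mk.inj (Set.mem_singleton_iff.1 h)
      exact ⟨Or.inr (Or.inl rfl), Or.inr (Or.inr rfl)⟩
  isUpperSet_label u v := (upperClosure _).upper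
  label_eq_empty u v h := by
    have h1 : N.label u v = ∅ := N.label_eq_empty u v fun h' => h (Or.inl h')
    have h2 : {c : A | (u, v) = (x, y) ∧ c = a} = ∅ :=
      Set.eq_empty_of_forall_notMem fun c hc => h (Or.inr hc.1)
    rw [h1, h2]
    simp

end Prenetwork

/-- The moves of `∀` after the initial round. -/
inductive Move (A : Type u) : Type u
  /-- composition move -/
  | comp (x y z : ℕ) (b c : A)
  /-- witness move -/
  | wit (x y : ℕ) (d e : A)
  /-- join move -/
  | join (x y : ℕ) (c d : A)

section Game

variable {A : Type u} [JoinSemilatticeOrderedSemigroup A]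

/-- The moves that `∀` may make when the prenetwork `N` has been played. -/
def Move.Legal (N : Prenetwork A) : Move A → Prop
  | .comp x y z b c =>
      x ∈ N.nodes ∧ y ∈ N.nodes ∧ z ∈ N.nodes ∧ b ∈ N.label x y ∧ c ∈ N.label y z
  | .wit x y d e => (x, y) ∈ N.edges ∧ ∃ c ∈ N.label x y, c ≤ d * e
  | .join x y c d => (x, y) ∈ N.edges ∧ c ⊔ d ∈ N.label x y

/-- `N'` is one of the responses that the rules allow to `∃` when the prenetwork `N` has been
played and `∀` has made the given move. The witness `z` may be an old node or a fresh one. -/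
def Move.Response (N : Prenetwork A) (m : Move A) (N' : Prenetwork A) : Prop :=
  match m with
  | .comp x _ z b c => N' = N.add x z (b * c)
  | .wit x y d e => ∃ z : ℕ, N' = (N.add x z d).add z y e
  | .join x y c d => N' = N.add x y c ∨ N' = N.add x y d

/-- When `∃` uses the strategy `s`, the prenetwork `s ms` is played after the moves `ms` of `∀`;
this says that `∀` has made only legal moves. -/
def LegalPlay (s : List (Move A) → Prenetwork A) (ms : List (Move A)) : Prop :=
  ∀ (i : ℕ) (hi : i < ms.length), (ms[i]).Legal (s (ms.take i))

variable (A) in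
/-- `∃` has a winning strategy in the game with round `0` followed by `n` rounds. A strategy tells
her, for the pair `(a, b)` chosen by `∀` in round `0` and his moves so far, which prenetwork to play.
She loses as soon as `b` belongs to the label of `(0, 1)`. -/
def HasWinningStrategy (n : ℕ) : Prop :=
  ∃ s : A → A → List (Move A) → Prenetwork A, ∀ a b : A, ¬ a ≤ b →
    s a b [] = Prenetwork.initial a ∧
    ∀ ms : List (Move A), ms.length ≤ n → LegalPlay (s a b) ms →
      b ∉ (s a b ms).label 0 1 ∧
      (ms.length < n → ∀ m : Move A, m.Legal (s a b ms) →
        m.Response (s a b ms) (s a b (ms ++ [m])))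

end Game

/-! ### Term networks and the sentences `ρ n` -/

/-- Terms of the signature in the bound variables `0, …, k - 1`. -/
abbrev Tm (k : ℕ) : Type := sig.Term (Empty ⊕ Fin k)

/-- Formulas of the signature whose free variables are among `0, …, k - 1`. -/
abbrev Fm (k : ℕ) : Type := sig.BoundedFormula Empty k

/-- The variable with index `i`. -/
def Tm.v {k : ℕ} (i : Fin k) : Tm k := FirstOrder.Language.Term.var (Sum.inr i)

/-- The term `s ; t`. -/
def Tm.comp {k : ℕ} (s t : Tm k) : Tm k :=
  FirstOrder.Language.Term.func (L := sig) (l := 2) Func.comp ![s, t]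

/-- The term `s + t`. -/
def Tm.join {k : ℕ} (s t : Tm k) : Tm k :=
  FirstOrder.Language.Term.func (L := sig) (l := 2) Func.join ![s, t]

/-- A term, seen as a term with two more variables available. -/
def Tm.lift {k : ℕ} (t : Tm k) : Tm (k + 2) :=
  t.relabel (Sum.map id (Fin.castAdd 2))

/-- The formula `s ≤ t`, that is `s + t = t`. -/
def Tm.le {k : ℕ} (s t : Tm k) : Fm k := (Tm.join s t).bdEqual t

/-- Conjunction of a list of formulas. -/
def bigAnd {k : ℕ} (l : List (Fm k)) : Fm k := l.foldr (· ⊓ ·) ⊤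

/-- Disjunction of a list of formulas. -/
def bigOr {k : ℕ} (l : List (Fm k)) : Fm k := l.foldr (· ⊔ ·) ⊥

/-- A term network: a finite network with nodes `0, …, size - 1` whose labels are finite sets of
terms; `(x, y, t)` is listed in `entries` when `t` belongs to the label of `(x, y)`. -/
structure TermNetwork (k : ℕ) where
  size : ℕ
  entries : List (ℕ × ℕ × Tm k)

namespace TermNetwork

/-- Add the term `t` to the label of `(x, y)`. -/
def add {k : ℕ} (N : TermNetwork k) (x y : ℕ) (t : Tm k) : TermNetwork k :=
  ⟨max N.size (max x y + 1), (x, y, t) :: N.entries⟩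

/-- A term network, seen as one with two more variables available. -/
def lift {k : ℕ} (N : TermNetwork k) : TermNetwork (k + 2) :=
  ⟨N.size, N.entries.map fun e => (e.1, e.2.1, e.2.2.lift)⟩

/-- The network with nodes `0`, `1` and the single edge `(0, 1)`, labelled with `{t}`. -/
def single {k : ℕ} (t : Tm k) : TermNetwork k := ⟨2, [(0, 1, t)]⟩

end TermNetwork

/-- `sigma n N v` says that `∃` can survive `n` more rounds when `N` has been played and `v` must
not get into the label of `(0, 1)`. Two universally quantified variables, with indices `k` and `k + 1`,
are introduced by a witness move and by a join move. -/
def sigma : ℕ → ∀ {k : ℕ}, TermNetwork k → Tm k → Fm k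
  | 0, _, N, v =>
      bigAnd ((N.entries.filter fun e => e.1 = 0 ∧ e.2.1 = 1).map fun e => (e.2.2.le v).not)
  | n + 1, k, N, v =>
      let p : Tm (k + 2) := Tm.v ((Fin.last k).castSucc)
      let q : Tm (k + 2) := Tm.v (Fin.last (k + 1))
      -- composition moves
      bigAnd (N.entries.flatMap fun e =>
        (N.entries.filter fun e' => e'.1 = e.2.1).map fun e' =>
          sigma n (N.add e.1 e'.2.1 (Tm.comp e.2.2 e'.2.2)) v) ⊓
      -- witness moves
      (bigAnd (N.entries.map fun e =>
        FirstOrder.Language.BoundedFormula.all (FirstOrder.Language.BoundedFormula.all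
          (((e.2.2.lift).le (Tm.comp p q)).imp
            (bigOr ((List.range (N.size + 1)).map fun w =>
              sigma n ((N.lift.add e.1 w p).add w e.2.1 q) v.lift))))) ⊓
      -- join moves
      bigAnd (N.entries.map fun e =>
        FirstOrder.Language.BoundedFormula.all (FirstOrder.Language.BoundedFormula.all
          (((e.2.2.lift).le (Tm.join p q)).imp
            (sigma n (N.lift.add e.1 e.2.1 p) v.lift ⊔
              sigma n (N.lift.add e.1 e.2.1 q) v.lift)))))

/-- The sentence `∀ v₀ ∀ v₁ (¬ v₀ ≤ v₁ → sigma n N v₁)`, where `N` is the network with the single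
edge `(0, 1)`, labelled with `v₀`. -/
def rho (n : ℕ) : sig.Sentence :=
  FirstOrder.Language.BoundedFormula.all (FirstOrder.Language.BoundedFormula.all
    (((Tm.v (k := 2) 0).le (Tm.v 1)).not.imp
      (sigma n (TermNetwork.single (Tm.v 0)) (Tm.v 1))))

/-! ### Recursively enumerable theories -/

/-- Gödel numbers of terms (an injective coding). -/
def termCode {k : ℕ} : Tm k → ℕ
  | .var (Sum.inr i) => 3 * i
  | .func Func.comp ts => 3 * Nat.pair (termCode (ts 0)) (termCode (ts 1)) + 1
  | .func Func.join ts => 3 * Nat.pair (termCode (ts 0)) (termCode (ts 1)) + 2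

/-- Gödel numbers of formulas (for each number of free variables, an injective coding; there are no relation
symbols in the signature). -/
def formulaCode : {k : ℕ} → Fm k → ℕ
  | _, .falsum => 0
  | _, .equal s t => 3 * Nat.pair (termCode s) (termCode t) + 1
  | _, .imp φ ψ => 3 * Nat.pair (formulaCode φ) (formulaCode ψ) + 2
  | _, .all φ => 3 * formulaCode φ + 3

/-- A theory is recursively enumerable if the set of the Gödel numbers of its sentences is. -/
def RecursivelyEnumerable (T : sig.Theory) : Prop :=
  REPred fun c : ℕ => ∃ φ ∈ T, formulaCode φ = c

/-! ### Two-sorted logic and pseudo-universal classes -/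

/-- The two sorts. -/
inductive Srt : Type
  /-- the sort `a` of the algebra -/
  | a
  /-- the sort `r` of the representation -/
  | r

/-- A two-sorted language that contains `L` in sort `a`, given by its further function symbols
(with the sorts of the arguments and of the value) and its further relation symbols. -/
structure TwoSorted (L : FirstOrder.Language.{0, 0}) where
  Fn : List Srt → Srt → Type
  Rel : List Srt → Type

namespace TwoSorted

variable {L : FirstOrder.Language.{0, 0}} (S : TwoSorted L)

/-- Terms of either sort in `p` variables of sort `a` and `q` variables of sort `r`. -/
inductive Trm (p q : ℕ) : Srt → Type
  | avar (i : Fin p) : Trm p q Srt.a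
  | rvar (i : Fin q) : Trm p q Srt.r
  | base {n : ℕ} (f : L.Functions n) (ts : Fin n → Trm p q Srt.a) : Trm p q Srt.a
  | app {ar : List Srt} {s : Srt} (f : S.Fn ar s)
      (ts : ∀ i : Fin ar.length, Trm p q (ar.get i)) : Trm p q s

/-- First-order formulas whose free variables are among `p` variables of sort `a` and `q` variables
of sort `r`. A quantifier binds the last variable of its sort. -/
inductive Fml : ℕ → ℕ → Type
  | eq {p q : ℕ} {s : Srt} (t₁ t₂ : Trm S p q s) : Fml p q
  | baseRel {p q n : ℕ} (R : L.Relations n) (ts : Fin n → Trm S p q Srt.a) : Fml p q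
  | rel {p q : ℕ} {ar : List Srt} (R : S.Rel ar)
      (ts : ∀ i : Fin ar.length, Trm S p q (ar.get i)) : Fml p q
  | neg {p q : ℕ} (φ : Fml p q) : Fml p q
  | and {p q : ℕ} (φ ψ : Fml p q) : Fml p q
  | or {p q : ℕ} (φ ψ : Fml p q) : Fml p q
  | allA {p q : ℕ} (φ : Fml (p + 1) q) : Fml p q
  | exA {p q : ℕ} (φ : Fml (p + 1) q) : Fml p q
  | allR {p q : ℕ} (φ : Fml p (q + 1)) : Fml p q
  | exR {p q : ℕ} (φ : Fml p (q + 1)) : Fml p q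

/-- The carrier of each sort. -/
@[reducible] def Carrier (M D : Type u) : Srt → Type u
  | Srt.a => M
  | Srt.r => D

/-- Interpretations of the further symbols in the carriers `M` (sort `a`) and `D` (sort `r`). With an
`L`-structure on `M`, this is a two-sorted structure whose `L`-reduct in sort `a` is `M`. -/
structure Interp (M D : Type u) where
  fn : ∀ {ar : List Srt} {s : Srt}, S.Fn ar s →
    (∀ i : Fin ar.length, Carrier M D (ar.get i)) → Carrier M D s
  rel : ∀ {ar : List Srt}, S.Rel ar → (∀ i : Fin ar.length, Carrier M D (ar.get i)) → Prop

variable {S}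

/-- The value of a term. -/
def Trm.realize {M D : Type u} [L.Structure M] (I : Interp S M D) {p q : ℕ}
    (va : Fin p → M) (vr : Fin q → D) : {s : Srt} → Trm S p q s → Carrier M D s
  | _, .avar i => va i
  | _, .rvar i => vr i
  | _, .base f ts => FirstOrder.Language.Structure.funMap f fun i => (ts i).realize I va vr
  | _, .app f ts => I.fn f fun i => (ts i).realize I va vr

/-- Truth of a formula. -/
def Fml.Realize {M D : Type u} [L.Structure M] (I : Interp S M D) :
    {p q : ℕ} → Fml S p q → (Fin p → M) → (Fin q → D) → Prop
  | _, _, .eq t₁ t₂, va, vr => t₁.realize I va vr = t₂.realize I va vr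
  | _, _, .baseRel R ts, va, vr =>
      FirstOrder.Language.Structure.RelMap R fun i => (ts i).realize I va vr
  | _, _, .rel R ts, va, vr => I.rel R fun i => (ts i).realize I va vr
  | _, _, .neg φ, va, vr => ¬ φ.Realize I va vr
  | _, _, .and φ ψ, va, vr => φ.Realize I va vr ∧ ψ.Realize I va vr
  | _, _, .or φ ψ, va, vr => φ.Realize I va vr ∨ ψ.Realize I va vr
  | _, _, .allA φ, va, vr => ∀ x : M, φ.Realize I (Fin.snoc va x) vr
  | _, _, .exA φ, va, vr => ∃ x : M, φ.Realize I (Fin.snoc va x) vr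
  | _, _, .allR φ, va, vr => ∀ x : D, φ.Realize I va (Fin.snoc vr x)
  | _, _, .exR φ, va, vr => ∃ x : D, φ.Realize I va (Fin.snoc vr x)

/-- Atomic formulas. -/
inductive Fml.IsAtomic : {p q : ℕ} → Fml S p q → Prop
  | eq {p q : ℕ} {s : Srt} (t₁ t₂ : Trm S p q s) : IsAtomic (Fml.eq t₁ t₂)
  | baseRel {p q n : ℕ} (R : L.Relations n) (ts : Fin n → Trm S p q Srt.a) :
      IsAtomic (Fml.baseRel R ts)
  | rel {p q : ℕ} {ar : List Srt} (R : S.Rel ar)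
      (ts : ∀ i : Fin ar.length, Trm S p q (ar.get i)) : IsAtomic (Fml.rel R ts)

/-- Formulas built from atomic and negated atomic ones with `∨`, `∧`, both universal quantifiers and
the existential quantifier of sort `r`. -/
inductive Fml.IsPseudoUniversal : {p q : ℕ} → Fml S p q → Prop
  | atom {p q : ℕ} {φ : Fml S p q} : φ.IsAtomic → IsPseudoUniversal φ
  | negAtom {p q : ℕ} {φ : Fml S p q} : φ.IsAtomic → IsPseudoUniversal (Fml.neg φ)
  | and {p q : ℕ} {φ ψ : Fml S p q} :
      IsPseudoUniversal φ → IsPseudoUniversal ψ → IsPseudoUniversal (Fml.and φ ψ)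
  | or {p q : ℕ} {φ ψ : Fml S p q} :
      IsPseudoUniversal φ → IsPseudoUniversal ψ → IsPseudoUniversal (Fml.or φ ψ)
  | allA {p q : ℕ} {φ : Fml S (p + 1) q} : IsPseudoUniversal φ → IsPseudoUniversal (Fml.allA φ)
  | allR {p q : ℕ} {φ : Fml S p (q + 1)} : IsPseudoUniversal φ → IsPseudoUniversal (Fml.allR φ)
  | exR {p q : ℕ} {φ : Fml S p (q + 1)} : IsPseudoUniversal φ → IsPseudoUniversal (Fml.exR φ)

/-- The class `K` of (non-empty) `L`-structures consists of the `L`-reducts, in sort `a`, of the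
models of the two-sorted theory `T`. -/
def Defines (S : TwoSorted L) (T : Set (Fml S 0 0))
    (K : ∀ (M : Type u) [L.Structure M], Prop) : Prop :=
  ∀ (M : Type u) [L.Structure M] [Nonempty M], K M ↔
    ∃ (D : Type u) (_ : Nonempty D) (I : Interp S M D),
      ∀ φ ∈ T, φ.Realize I (Fin.elim0 : Fin 0 → M) (Fin.elim0 : Fin 0 → D)

end TwoSorted

/-- A pseudo-universal class of `L`-structures: one with a two-sorted defining theory, all of whose
function symbols outside `L` take values in sort `r`, and all of whose sentences are built from atomic
and negated atomic formulas with `∨`, `∧`, the universal quantifiers and the existential quantifier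
of sort `r`. -/
def PseudoUniversal (L : FirstOrder.Language.{0, 0}) (K : ∀ (M : Type u) [L.Structure M], Prop) : Prop :=
  ∃ (S : TwoSorted L) (T : Set (TwoSorted.Fml S 0 0)),
    (∀ ar : List Srt, IsEmpty (S.Fn ar Srt.a)) ∧
    (∀ φ ∈ T, φ.IsPseudoUniversal) ∧
    TwoSorted.Defines S T K

end RelRep

/-! Everything passes through the predicate `Survives`, which unfolds the game by recursion on the
number of rounds, with a set of labelled edges as position and no upward closure. Its key property
is `Survives.of_hom`: a position with boundedly many nodes that maps homomorphically, up to
enlarging labels, into a survivable one is itself survivable. Hence closing labels upwards changes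
nothing, and a fresh witness is at least as good as an old one. So one predicate describes both the
game (`hasWinningStrategy_iff_survives`) and the truth of `sigma` (`realize_sigma`), where a finite
disjunction over nodes is enough.

A representation yields survival for any number of rounds: `∃` keeps the network mapped into the
base, starting from a pair in the relation of `a` but not in that of `b`. Conversely, let `∃`
survive every number of rounds. The type `Node` names in advance a witness for every product on
every pair of nodes, so being a saturated network becomes a set of propositional conditions, the
rule instances. Finitely many instances mention only a finite set `F` of facts. Each violated
instance suggests a move of `∀`, and the answer adds a missing member of `F`, so boundedly many
rounds produce a labelling that obeys them all (`Survives.exists_labelling`). An ultrafilter limit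
of such labellings is saturated (`exists_saturated`), and the disjoint union of saturated
labellings, one for each pair of distinct elements, is a representation
(`hasRepresentation_of_saturated`).

The same compactness argument gives the universal axioms, for arbitrary structures of the signature.
A structure fails to be representable exactly when finitely many equations true in it
propositionally force two distinct elements to label the edge `(src, tgt)` alike. With elements
replaced by variables, each such forcing is an axiom: the equations imply that the first two
variables are equal. Whether a given list of instances forces this is decided by a finite truth
table, whence recursive enumerability.

For pseudo-universality a ternary relation symbol for the representation suffices: the only
existential quantifiers needed range over points of the base. -/

namespace RelRep

/-! ### Survival in the game and its monotonicity -/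

section Survival

variable {A : Type u}

/-- The nodes of `S` are bounded. -/
def BoundedNodes (S : Set (ℕ × ℕ × A)) : Prop :=
  ∃ B, ∀ x y t, (x, y, t) ∈ S → x < B ∧ y < B

theorem BoundedNodes.insert {S : Set (ℕ × ℕ × A)} (hS : BoundedNodes S) (x y : ℕ) (t : A) :
    BoundedNodes (insert (x, y, t) S) := by
  obtain ⟨B, hB⟩ := hS
  refine ⟨max B (max x y + 1), fun x' y' t' h => ?_⟩
  rcases h with h | h
  · simp only [Prod.mk.injEq] at h
    omega
  · have := hB _ _ _ h
    omega

variable [JoinSemilatticeOrderedSemigroup A]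

theorem mul_le_mul_of_le_of_le {a b c d : A} (h : a ≤ c) (h' : b ≤ d) : a * b ≤ c * d := by
  have h1 : a * b ≤ a * d := by
    have := JoinSemilatticeOrderedSemigroup.mul_sup' a b d
    rw [sup_eq_right.2 h'] at this
    exact sup_eq_right.1 this.symm
  have h2 : a * d ≤ c * d := by
    have := JoinSemilatticeOrderedSemigroup.sup_mul' a c d
    rw [sup_eq_right.2 h] at this
    exact sup_eq_right.1 this.symm
  exact h1.trans h2

/-- The player `∃` can survive `n` more rounds from the network whose labels are the upward closures
of the sets `{t | (x, y, t) ∈ S}`, if `∀` uses only the listed elements. -/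
def Survives : ℕ → Set (ℕ × ℕ × A) → A → Prop
  | 0, S, b => ∀ t, (0, 1, t) ∈ S → ¬ t ≤ b
  | n + 1, S, b =>
      (∀ x y z t t', (x, y, t) ∈ S → (y, z, t') ∈ S → Survives n (insert (x, z, t * t') S) b) ∧
      (∀ x y t p q, (x, y, t) ∈ S → t ≤ p * q →
        ∃ w, Survives n (insert (w, y, q) (insert (x, w, p) S)) b) ∧
      (∀ x y t p q, (x, y, t) ∈ S → t ≤ p ⊔ q →
        Survives n (insert (x, y, p) S) b ∨ Survives n (insert (x, y, q) S) b)

/-- The map `h` sends the network `S` into the network `S'`, up to upward closure of labels, and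
preserves the nodes `0` and `1`. -/
structure NetworkHom (h : ℕ → ℕ) (S S' : Set (ℕ × ℕ × A)) : Prop where
  zero : h 0 = 0
  one : h 1 = 1
  map : ∀ x y t, (x, y, t) ∈ S → ∃ t' ≤ t, (h x, h y, t') ∈ S'

theorem NetworkHom.insert {h : ℕ → ℕ} {S S' : Set (ℕ × ℕ × A)} (H : NetworkHom h S S')
    {x y x' y' : ℕ} {t t' : A} (hx : h x = x') (hy : h y = y') (ht : t' ≤ t) :
    NetworkHom h (insert (x, y, t) S) (insert (x', y', t') S') := by
  refine ⟨H.zero, H.one, fun u v s hs => ?_⟩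
  rcases hs with hs | hs
  · simp only [Prod.mk.injEq] at hs
    obtain ⟨rfl, rfl, rfl⟩ := hs
    exact ⟨t', ht, Or.inl (by rw [hx, hy])⟩
  · obtain ⟨s', h1, h2⟩ := H.map u v s hs
    exact ⟨s', h1, Or.inr h2⟩

theorem NetworkHom.update {h : ℕ → ℕ} {S S' : Set (ℕ × ℕ × A)} (H : NetworkHom h S S')
    {B : ℕ} (hB : ∀ x y t, (x, y, t) ∈ S → x < B ∧ y < B) (hB2 : 2 ≤ B) (w : ℕ) :
    NetworkHom (Function.update h B w) S S' := by
  refine ⟨?_, ?_, fun x y t ht => ?_⟩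
  · rw [Function.update_of_ne (by omega), H.zero]
  · rw [Function.update_of_ne (by omega), H.one]
  · have := hB x y t ht
    rw [Function.update_of_ne (by omega), Function.update_of_ne (by omega)]
    exact H.map x y t ht

theorem NetworkHom.of_subset {S S' : Set (ℕ × ℕ × A)} (H : S ⊆ S') : NetworkHom id S S' :=
  ⟨rfl, rfl, fun _ _ t ht => ⟨t, le_rfl, H ht⟩⟩

/-- A move in `S` translates along `h` to a move in `S'`, and the answer there is copied back. A
witness chosen for `S'` may have no preimage, so a new node of `S` is introduced and sent to it;
boundedness of `S` provides this node. -/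
theorem Survives.of_hom {n : ℕ} {b : A} {h : ℕ → ℕ} {S S' : Set (ℕ × ℕ × A)}
    (hS : BoundedNodes S) (H : NetworkHom h S S') (hs : Survives n S' b) : Survives n S b := by
  induction n generalizing h S S' with
  | zero =>
    intro t ht htb
    obtain ⟨t', h1, h2⟩ := H.map _ _ _ ht
    rw [H.zero, H.one] at h2
    exact hs t' h2 (h1.trans htb)
  | succ n ih =>
    obtain ⟨hc, hw, hj⟩ := hs
    refine ⟨fun x y z t t' ht ht' => ?_, fun x y t p q ht hpq => ?_, fun x y t p q ht hpq => ?_⟩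
    · obtain ⟨u, h1, h2⟩ := H.map _ _ _ ht
      obtain ⟨u', h1', h2'⟩ := H.map _ _ _ ht'
      exact ih (hS.insert _ _ _) (H.insert rfl rfl (mul_le_mul_of_le_of_le h1 h1'))
        (hc _ _ _ _ _ h2 h2')
    · obtain ⟨u, h1, h2⟩ := H.map _ _ _ ht
      obtain ⟨w, hw⟩ := hw _ _ _ p q h2 (h1.trans hpq)
      obtain ⟨B, hB⟩ := id hS
      have hB' : ∀ x y t, (x, y, t) ∈ S → x < B + 2 ∧ y < B + 2 := fun x y t ht => by
        have := hB x y t ht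
        omega
      have hxy := hB x y t ht
      refine ⟨B + 2, ih ((hS.insert _ _ _).insert _ _ _)
        -- The new node is `B + 2` rather than `B`, since `B` may be `0` or `1` and `h` must not
        -- change at these two nodes.
        (((H.update hB' (by omega) w).insert ?_ ?_ le_rfl).insert ?_ ?_ le_rfl) hw⟩
      · exact Function.update_of_ne (by omega) _ _
      · exact Function.update_self _ _ _
      · exact Function.update_self _ _ _
      · exact Function.update_of_ne (by omega) _ _
    · obtain ⟨u, h1, h2⟩ := H.map _ _ _ ht
      rcases hj _ _ _ p q h2 (h1.trans hpq) with h | h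
      · exact Or.inl (ih (hS.insert _ _ _) (H.insert rfl rfl le_rfl) h)
      · exact Or.inr (ih (hS.insert _ _ _) (H.insert rfl rfl le_rfl) h)

/-- Collapsing the fresh node `B` onto `w` is a homomorphism. This lets a single fresh node stand
for all witnesses outside a finite network. -/
theorem Survives.fresh {n : ℕ} {b : A} {S : Set (ℕ × ℕ × A)} {B x y w : ℕ} {p q : A}
    (hB : ∀ x y t, (x, y, t) ∈ S → x < B ∧ y < B) (hB2 : 2 ≤ B) (hx : x < B) (hy : y < B)
    (h : Survives n (insert (w, y, q) (insert (x, w, p) S)) b) :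
    Survives n (insert (B, y, q) (insert (x, B, p) S)) b := by
  refine h.of_hom (((show BoundedNodes S from ⟨B, hB⟩).insert _ _ _).insert _ _ _)
    (h := Function.update id B w)
    (((NetworkHom.update (NetworkHom.of_subset subset_rfl) hB hB2 w).insert
      ?_ ?_ le_rfl).insert ?_ ?_ le_rfl)
  · exact Function.update_of_ne (by omega) _ _
  · exact Function.update_self _ _ _
  · exact Function.update_self _ _ _
  · exact Function.update_of_ne (by omega) _ _

theorem Survives.zero {n : ℕ} {b : A} {S : Set (ℕ × ℕ × A)} (h : Survives n S b) :
    Survives 0 S b := by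
  induction n generalizing S with
  | zero => exact h
  | succ n ih =>
    intro t ht
    -- The idle join move `t ≤ t ⊔ t` leaves the position unchanged and uses up a round.
    have := h.2.2 0 1 t t t ht (by simp)
    rw [Set.insert_eq_of_mem ht, or_self] at this
    exact ih this t ht

/-! ### Survival and the game -/

/-- The set of labelled edges of a prenetwork. -/
def Prenetwork.triples (N : Prenetwork A) : Set (ℕ × ℕ × A) := {e | e.2.2 ∈ N.label e.1 e.2.1}

theorem Prenetwork.mem_triples {N : Prenetwork A} {x y : ℕ} {t : A} :
    (x, y, t) ∈ N.triples ↔ t ∈ N.label x y := Iff.rfl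

theorem Prenetwork.edge_of_mem_label {N : Prenetwork A} {x y : ℕ} {t : A}
    (h : t ∈ N.label x y) : (x, y) ∈ N.edges := by
  by_contra h'
  rw [N.label_eq_empty x y h'] at h
  exact h

theorem Prenetwork.mem_label_add {N : Prenetwork A} {x y u v : ℕ} {a c : A} :
    c ∈ (N.add x y a).label u v ↔ ∃ c' ≤ c, (u, v, c') ∈ insert (x, y, a) N.triples := by
  simp only [Prenetwork.add, SetLike.mem_coe, mem_upperClosure, Set.mem_union, Set.mem_insert_iff,
    Set.mem_ofPred_eq, Prenetwork.mem_triples, Prod.mk.injEq]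
  constructor
  · rintro ⟨c', h | h, h'⟩
    · exact ⟨c', h', Or.inr h⟩
    · exact ⟨c', h', Or.inl ⟨h.1.1, h.1.2, h.2⟩⟩
  · rintro ⟨c', h', h | h⟩
    · exact ⟨c', Or.inr ⟨⟨h.1, h.2.1⟩, h.2.2⟩, h'⟩
    · exact ⟨c', Or.inl h, h'⟩

theorem Prenetwork.insert_subset_triples_add (N : Prenetwork A) (x y : ℕ) (a : A) :
    insert (x, y, a) N.triples ⊆ (N.add x y a).triples := fun _ h =>
  Prenetwork.mem_label_add.2 ⟨_, le_rfl, h⟩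

theorem Prenetwork.hom_triples_add (N : Prenetwork A) (x y : ℕ) (a : A) :
    NetworkHom id (N.add x y a).triples (insert (x, y, a) N.triples) :=
  ⟨rfl, rfl, fun _ _ _ h => Prenetwork.mem_label_add.1 h⟩

theorem Prenetwork.boundedNodes_add {N : Prenetwork A} (h : BoundedNodes N.triples) (x y : ℕ)
    (a : A) : BoundedNodes (N.add x y a).triples := by
  obtain ⟨B, hB⟩ := h.insert x y a
  refine ⟨B, fun u v c hc => ?_⟩
  obtain ⟨c', -, h'⟩ := Prenetwork.mem_label_add.1 hc
  exact hB _ _ _ h'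

/-- The identity on nodes is a homomorphism both ways, so the upward closure performed by `add` is
invisible to survival. -/
theorem Prenetwork.survives_add {N : Prenetwork A} (hN : BoundedNodes N.triples) {x y n : ℕ}
    {a b : A} :
    Survives n (N.add x y a).triples b ↔ Survives n (insert (x, y, a) N.triples) b :=
  ⟨fun h => h.of_hom (hN.insert _ _ _)
      (NetworkHom.of_subset (N.insert_subset_triples_add x y a)),
    fun h => h.of_hom (Prenetwork.boundedNodes_add hN x y a) (N.hom_triples_add x y a)⟩

theorem Prenetwork.survives_add_add {N : Prenetwork A} (hN : BoundedNodes N.triples)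
    {x y z n : ℕ} {d e b : A} :
    Survives n ((N.add x z d).add z y e).triples b ↔
      Survives n (insert (z, y, e) (insert (x, z, d) N.triples)) b := by
  rw [Prenetwork.survives_add (Prenetwork.boundedNodes_add hN x z d)]
  refine ⟨fun h => h.of_hom ((hN.insert _ _ _).insert _ _ _) (h := id) ?_,
    fun h => h.of_hom ((Prenetwork.boundedNodes_add hN x z d).insert _ _ _) (h := id) ?_⟩
  · exact (NetworkHom.of_subset (N.insert_subset_triples_add x z d)).insert rfl rfl le_rfl
  · exact (N.hom_triples_add x z d).insert rfl rfl le_rfl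

theorem Prenetwork.boundedNodes_initial (a : A) : BoundedNodes (Prenetwork.initial a).triples := by
  refine ⟨2, fun x y t h => ?_⟩
  have := h.1
  simp only [Prod.mk.injEq] at this
  omega

theorem Prenetwork.survives_initial {n : ℕ} {a b : A} :
    Survives n (Prenetwork.initial a).triples b ↔ Survives n {(0, 1, a)} b := by
  refine ⟨fun h => h.of_hom (h := id) ⟨2, ?_⟩ (NetworkHom.of_subset ?_),
    fun h => h.of_hom (Prenetwork.boundedNodes_initial a) (h := id) ⟨rfl, rfl, ?_⟩⟩
  · rintro x y t h
    simp only [Set.mem_singleton_iff, Prod.mk.injEq] at h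
    omega
  · rintro _ rfl
    exact ⟨rfl, le_rfl⟩
  · rintro x y t ⟨h, h'⟩
    simp only [Prod.mk.injEq] at h
    obtain ⟨rfl, rfl⟩ := h
    exact ⟨a, h', rfl⟩

/-- Survival gives a response to every legal move. -/
theorem Survives.exists_response {N : Prenetwork A} (hN : BoundedNodes N.triples) {n : ℕ} {b : A}
    (h : Survives (n + 1) N.triples b) {m : Move A} (hm : m.Legal N) :
    ∃ N', m.Response N N' ∧ BoundedNodes N'.triples ∧ Survives n N'.triples b := by
  cases m with
  | comp x y z c d =>
    exact ⟨_, rfl, Prenetwork.boundedNodes_add hN _ _ _,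
      (Prenetwork.survives_add hN).2 (h.1 x y z c d hm.2.2.2.1 hm.2.2.2.2)⟩
  | wit x y d e =>
    obtain ⟨-, c, hc, hcde⟩ := hm
    obtain ⟨w, hw⟩ := h.2.1 x y c d e hc hcde
    exact ⟨_, ⟨w, rfl⟩,
      Prenetwork.boundedNodes_add (Prenetwork.boundedNodes_add hN _ _ _) _ _ _,
      (Prenetwork.survives_add_add hN).2 hw⟩
  | join x y c d =>
    rcases h.2.2 x y _ c d hm.2 le_rfl with hw | hw
    · exact ⟨_, Or.inl rfl, Prenetwork.boundedNodes_add hN _ _ _,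
        (Prenetwork.survives_add hN).2 hw⟩
    · exact ⟨_, Or.inr rfl, Prenetwork.boundedNodes_add hN _ _ _,
        (Prenetwork.survives_add hN).2 hw⟩

theorem Move.Response.boundedNodes {N N' : Prenetwork A} (hN : BoundedNodes N.triples)
    {m : Move A} (h : m.Response N N') : BoundedNodes N'.triples := by
  cases m with
  | comp x y z c d =>
    obtain rfl := h
    exact Prenetwork.boundedNodes_add hN _ _ _
  | wit x y d e =>
    obtain ⟨w, rfl⟩ := h
    exact Prenetwork.boundedNodes_add (Prenetwork.boundedNodes_add hN _ _ _) _ _ _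
  | join x y c d =>
    rcases h with rfl | rfl
    · exact Prenetwork.boundedNodes_add hN _ _ _
    · exact Prenetwork.boundedNodes_add hN _ _ _

theorem Survives.of_responses {N : Prenetwork A} (hN : BoundedNodes N.triples) {n : ℕ} {b : A}
    (h : ∀ m : Move A, m.Legal N → ∃ N', m.Response N N' ∧ Survives n N'.triples b) :
    Survives (n + 1) N.triples b := by
  refine ⟨fun x y z t t' ht ht' => ?_, fun x y t p q ht hpq => ?_, fun x y t p q ht hpq => ?_⟩
  · have e := N.edges_subset _ _ (Prenetwork.edge_of_mem_label ht)
    have e' := N.edges_subset _ _ (Prenetwork.edge_of_mem_label ht')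
    obtain ⟨_, rfl, hs⟩ := h (.comp x y z t t') ⟨e.1, e.2, e'.2, ht, ht'⟩
    exact (Prenetwork.survives_add hN).1 hs
  · obtain ⟨_, ⟨w, rfl⟩, hs⟩ := h (.wit x y p q) ⟨Prenetwork.edge_of_mem_label ht, t, ht, hpq⟩
    exact ⟨w, (Prenetwork.survives_add_add hN).1 hs⟩
  · obtain ⟨_, rfl | rfl, hs⟩ := h (.join x y p q)
      ⟨Prenetwork.edge_of_mem_label ht, N.isUpperSet_label x y hpq ht⟩
    · exact Or.inl ((Prenetwork.survives_add hN).1 hs)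
    · exact Or.inr ((Prenetwork.survives_add hN).1 hs)

open Classical in
/-- Answer the moves in the list one after the other, keeping survival for as many rounds as
possible. -/
noncomputable def followSurvival (b : A) : ℕ → Prenetwork A → List (Move A) → Prenetwork A
  | 0, N, _ => N
  | _ + 1, N, [] => N
  | n + 1, N, m :: ms =>
      if h : ∃ N', m.Response N N' ∧ BoundedNodes N'.triples ∧ Survives n N'.triples b then
        followSurvival b n h.choose ms
      -- In a legal play of at most `n` moves from a survivable position with bounded nodes, this
      -- default is never used.
      else N

theorem followSurvival_nil (b : A) (n : ℕ) (N : Prenetwork A) : followSurvival b n N [] = N := by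
  cases n <;> rfl

theorem followSurvival_cons {b : A} {n : ℕ} {N : Prenetwork A} {m : Move A}
    (h : ∃ N', m.Response N N' ∧ BoundedNodes N'.triples ∧ Survives n N'.triples b)
    (ms : List (Move A)) :
    followSurvival b (n + 1) N (m :: ms) = followSurvival b n h.choose ms := by
  rw [followSurvival, dif_pos h]

theorem followSurvival_spec {b : A} {n : ℕ} {N : Prenetwork A} (hN : BoundedNodes N.triples)
    (h : Survives n N.triples b) (ms : List (Move A)) (hms : ms.length ≤ n)
    (hl : LegalPlay (followSurvival b n N) ms) :
    b ∉ (followSurvival b n N ms).label 0 1 ∧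
      (ms.length < n → ∀ m : Move A, m.Legal (followSurvival b n N ms) →
        m.Response (followSurvival b n N ms) (followSurvival b n N (ms ++ [m]))) := by
  induction ms generalizing n N with
  | nil =>
    rw [followSurvival_nil]
    refine ⟨fun hb => h.zero b hb le_rfl, fun hn m hm => ?_⟩
    obtain ⟨n, rfl⟩ : ∃ k, n = k + 1 := ⟨n - 1, by simp at hn; omega⟩
    have hex := h.exists_response hN hm
    rw [List.nil_append, followSurvival_cons hex, followSurvival_nil]
    exact hex.choose_spec.1
  | cons m ms ih =>
    obtain ⟨n, rfl⟩ : ∃ k, n = k + 1 := ⟨n - 1, by simp at hms; omega⟩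
    have hm : m.Legal N := by
      have := hl 0 (by simp)
      rwa [List.take_zero, followSurvival_nil] at this
    have hex := h.exists_response hN hm
    simp only [List.cons_append, followSurvival_cons hex]
    have := ih hex.choose_spec.2.1 hex.choose_spec.2.2 (by simpa using hms) (fun i hi => by
      have := hl (i + 1) (by simpa using hi)
      rwa [List.take_succ_cons, followSurvival_cons hex, List.getElem_cons_succ] at this)
    simpa using this

/-- Induction on the number `k` of rounds still to come: the strategy answers each legal move, and
the play prolonged by this move is again legal. -/
theorem survives_of_strategy {n : ℕ} {b : A} {s : List (Move A) → Prenetwork A}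
    (h : ∀ ms : List (Move A), ms.length ≤ n → LegalPlay s ms →
      b ∉ (s ms).label 0 1 ∧
      (ms.length < n → ∀ m : Move A, m.Legal (s ms) → m.Response (s ms) (s (ms ++ [m]))))
    (k : ℕ) (ms : List (Move A)) (hk : ms.length + k = n) (hms : LegalPlay s ms)
    (hb : BoundedNodes (s ms).triples) : Survives k (s ms).triples b := by
  induction k generalizing ms with
  | zero =>
    intro t ht htb
    exact (h ms hk.le hms).1 ((s ms).isUpperSet_label _ _ htb ht)
  | succ k ih =>
    refine Survives.of_responses hb fun m hm => ?_
    have hr := (h ms (by omega) hms).2 (by omega) m hm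
    refine ⟨_, hr, ih (ms ++ [m]) (by simp; omega) (fun i hi => ?_) (hr.boundedNodes hb)⟩
    rw [List.length_append, List.length_singleton] at hi
    rcases Nat.lt_succ_iff_lt_or_eq.1 hi with hi | rfl
    · rw [List.getElem_append_left hi, List.take_append_of_le_length hi.le]
      exact hms i hi
    · simpa using hm

/-- Winning strategies are the same as survival from all initial networks. -/
theorem hasWinningStrategy_iff_survives {n : ℕ} :
    HasWinningStrategy A n ↔ ∀ a b : A, ¬ a ≤ b → Survives n {(0, 1, a)} b := by
  constructor
  · rintro ⟨s, hs⟩ a b hab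
    obtain ⟨h0, h⟩ := hs a b hab
    rw [← Prenetwork.survives_initial, ← h0]
    exact survives_of_strategy h n [] (by simp) (fun i hi => absurd hi (by simp))
      (h0 ▸ Prenetwork.boundedNodes_initial a)
  · intro h
    refine ⟨fun a b => followSurvival b n (Prenetwork.initial a), fun a b hab =>
      ⟨followSurvival_nil _ _ _, fun ms hms hl => ?_⟩⟩
    exact followSurvival_spec (Prenetwork.boundedNodes_initial a)
      (Prenetwork.survives_initial.2 (h a b hab)) ms hms hl

/-- Whoever can map into a representation survives. -/
theorem survives_of_representation {D : Type u} {R : A → SetRel D D}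
    (hR : IsRepresentation (fun a b : A => a * b) (fun a b : A => a ⊔ b) R) {n : ℕ} {b : A}
    {S : Set (ℕ × ℕ × A)} (hS : BoundedNodes S) {h : ℕ → D}
    (hm : ∀ x y t, (x, y, t) ∈ S → (h x, h y) ∈ R t) (hb : (h 0, h 1) ∉ R b) :
    Survives n S b := by
  have mono : ∀ {a c : A}, a ≤ c → R a ⊆ R c := fun {a c} hac => by
    have := hR.map_join a c
    rw [sup_eq_right.2 hac] at this
    rw [this]
    exact Set.subset_union_left
  have hins : ∀ {S : Set (ℕ × ℕ × A)} {h : ℕ → D} {x y t},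
      (∀ x y t, (x, y, t) ∈ S → (h x, h y) ∈ R t) → (h x, h y) ∈ R t →
      ∀ x' y' t', (x', y', t') ∈ insert (x, y, t) S → (h x', h y') ∈ R t' := by
    rintro S h x y t hm ht x' y' t' (h' | h')
    · simp only [Prod.mk.injEq] at h'
      obtain ⟨rfl, rfl, rfl⟩ := h'
      exact ht
    · exact hm _ _ _ h'
  induction n generalizing S h with
  | zero => exact fun t ht htb => hb (mono htb (hm _ _ _ ht))
  | succ n ih =>
    refine ⟨fun x y z t t' ht ht' => ?_, fun x y t p q ht hpq => ?_, fun x y t p q ht hpq => ?_⟩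
    · refine ih (hS.insert _ _ _) (hins hm ?_) hb
      rw [hR.map_comp]
      exact ⟨_, hm _ _ _ ht, hm _ _ _ ht'⟩
    · have := mono hpq (hm _ _ _ ht)
      rw [hR.map_comp] at this
      obtain ⟨d, h1, h2⟩ := this
      obtain ⟨B, hB⟩ := id hS
      have hxy := hB _ _ _ ht
      have hu : ∀ {x}, x < B → Function.update h (B + 2) d x = h x := fun hx =>
        Function.update_of_ne (by omega) _ _
      have hm' : ∀ x y t, (x, y, t) ∈ S →
          (Function.update h (B + 2) d x, Function.update h (B + 2) d y) ∈ R t := by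
        intro x y t ht
        rw [hu (hB _ _ _ ht).1, hu (hB _ _ _ ht).2]
        exact hm _ _ _ ht
      -- The new node is sent to the intermediate point `d`. It lies above `1`, so the images of `0`
      -- and `1` stay as they are.
      refine ⟨B + 2, ih ((hS.insert _ _ _).insert _ _ _) (h := Function.update h (B + 2) d)
        (hins (hins hm' ?_) ?_) ?_⟩
      · rwa [hu hxy.1, Function.update_self]
      · rwa [hu hxy.2, Function.update_self]
      · rwa [Function.update_of_ne (by omega), Function.update_of_ne (by omega)]
    · have := mono hpq (hm _ _ _ ht)
      rw [hR.map_join] at this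
      rcases this with h1 | h1
      · exact Or.inl (ih (hS.insert _ _ _) (hins hm h1) hb)
      · exact Or.inr (ih (hS.insert _ _ _) (hins hm h1) hb)

end Survival

/-! ### The sentences `rho` express survival -/

section Sentences

variable {A : Type u} [JoinSemilatticeOrderedSemigroup A]

theorem realize_bigAnd {k : ℕ} {l : List (Fm k)} {M : Type u} [sig.Structure M] {v : Empty → M}
    {xs : Fin k → M} : (bigAnd l).Realize v xs ↔ ∀ φ ∈ l, φ.Realize v xs := by
  induction l with
  | nil => simp [bigAnd]
  | cons φ l ih =>
    have ih' : (List.foldr (· ⊓ ·) ⊤ l).Realize v xs ↔ ∀ φ ∈ l, φ.Realize v xs := ih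
    simp [bigAnd, ih']

theorem realize_bigOr {k : ℕ} {l : List (Fm k)} {M : Type u} [sig.Structure M] {v : Empty → M}
    {xs : Fin k → M} : (bigOr l).Realize v xs ↔ ∃ φ ∈ l, φ.Realize v xs := by
  induction l with
  | nil => simp [bigOr]
  | cons φ l ih =>
    have ih' : (List.foldr (· ⊔ ·) ⊥ l).Realize v xs ↔ ∃ φ ∈ l, φ.Realize v xs := ih
    simp [bigOr, ih']

/-- The value of a term under an assignment. -/
def Tm.eval {M : Type u} [sig.Structure M] {k : ℕ} (xs : Fin k → M) (t : Tm k) : M :=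
  t.realize (Sum.elim (default : Empty → M) xs)

theorem Tm.eval_v {M : Type u} [sig.Structure M] {k : ℕ} (xs : Fin k → M) (i : Fin k) :
    (Tm.v i).eval xs = xs i := rfl

theorem Tm.eval_comp {M : Type u} [sig.Structure M] {k : ℕ} (xs : Fin k → M) (s t : Tm k) :
    (Tm.comp s t).eval xs = compOp (s.eval xs) (t.eval xs) := by
  refine congrArg _ (funext fun i => ?_)
  fin_cases i <;> rfl

theorem Tm.eval_join {M : Type u} [sig.Structure M] {k : ℕ} (xs : Fin k → M) (s t : Tm k) :
    (Tm.join s t).eval xs = joinOp (s.eval xs) (t.eval xs) := by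
  refine congrArg _ (funext fun i => ?_)
  fin_cases i <;> rfl

theorem compOp_eq_mul (a b : A) : compOp a b = a * b := rfl

theorem joinOp_eq_sup (a b : A) : joinOp a b = a ⊔ b := rfl

theorem Tm.eval_lift {M : Type u} [sig.Structure M] {k : ℕ} (xs : Fin k → M) (p q : M) (t : Tm k) :
    t.lift.eval (Fin.snoc (Fin.snoc xs p : Fin (k + 1) → M) q : Fin (k + 2) → M) = t.eval xs := by
  rw [Tm.eval, Tm.lift, FirstOrder.Language.Term.realize_relabel, Tm.eval]
  congr 1
  funext i
  rcases i with i | i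
  · exact i.elim
  · change (Fin.snoc (Fin.snoc xs p : Fin (k + 1) → M) q : Fin (k + 2) → M)
      (Fin.castSucc (Fin.castSucc i)) = xs i
    rw [Fin.snoc_castSucc, Fin.snoc_castSucc]

theorem realize_le {k : ℕ} (xs : Fin k → A) (s t : Tm k) :
    (s.le t).Realize default xs ↔ s.eval xs ≤ t.eval xs := by
  rw [← sup_eq_right, ← joinOp_eq_sup, ← Tm.eval_join]
  rfl

/-- The network of elements named by a term network. -/
def TermNetwork.triples {k : ℕ} (N : TermNetwork k) (xs : Fin k → A) : Set (ℕ × ℕ × A) :=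
  {e | ∃ t, (e.1, e.2.1, t) ∈ N.entries ∧ t.eval xs = e.2.2}

theorem TermNetwork.mem_triples {k : ℕ} {N : TermNetwork k} {xs : Fin k → A} {x y : ℕ} {a : A} :
    (x, y, a) ∈ N.triples xs ↔ ∃ t, (x, y, t) ∈ N.entries ∧ t.eval xs = a := Iff.rfl

theorem TermNetwork.triples_add {k : ℕ} (N : TermNetwork k) (xs : Fin k → A) (x y : ℕ)
    (t : Tm k) : (N.add x y t).triples xs = insert (x, y, t.eval xs) (N.triples xs) := by
  ext ⟨u, v, a⟩
  simp only [TermNetwork.mem_triples, TermNetwork.add, List.mem_cons, Set.mem_insert_iff,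
    Prod.mk.injEq]
  constructor
  · rintro ⟨s, ⟨rfl, rfl, rfl⟩ | h, rfl⟩
    · exact Or.inl ⟨rfl, rfl, rfl⟩
    · exact Or.inr ⟨s, h, rfl⟩
  · rintro (⟨rfl, rfl, rfl⟩ | ⟨s, h, rfl⟩)
    · exact ⟨t, Or.inl ⟨rfl, rfl, rfl⟩, rfl⟩
    · exact ⟨s, Or.inr h, rfl⟩

theorem TermNetwork.triples_lift {k : ℕ} (N : TermNetwork k) (xs : Fin k → A) (p q : A) :
    N.lift.triples (Fin.snoc (Fin.snoc xs p : Fin (k + 1) → A) q : Fin (k + 2) → A) =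
      N.triples xs := by
  ext ⟨u, v, a⟩
  simp only [TermNetwork.mem_triples, TermNetwork.lift, List.mem_map, Prod.mk.injEq, Prod.exists]
  constructor
  · rintro ⟨s, ⟨x, y, t, h, rfl, rfl, rfl⟩, rfl⟩
    exact ⟨t, h, (Tm.eval_lift xs p q t).symm⟩
  · rintro ⟨t, h, rfl⟩
    exact ⟨_, ⟨_, _, t, h, rfl, rfl, rfl⟩, Tm.eval_lift xs p q t⟩

/-- The nodes of the entries are nodes of the network, and so are `0` and `1`. -/
structure TermNetwork.Proper {k : ℕ} (N : TermNetwork k) : Prop where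
  two_le : 2 ≤ N.size
  lt_size : ∀ e ∈ N.entries, e.1 < N.size ∧ e.2.1 < N.size

theorem TermNetwork.Proper.add {k : ℕ} {N : TermNetwork k} (h : N.Proper) (x y : ℕ) (t : Tm k) :
    (N.add x y t).Proper := by
  have := h.two_le
  refine ⟨by simp only [TermNetwork.add]; omega, fun e he => ?_⟩
  rcases List.mem_cons.1 he with rfl | he
  · simp only [TermNetwork.add]
    omega
  · have := h.lt_size e he
    simp only [TermNetwork.add]
    omega

theorem TermNetwork.Proper.lift {k : ℕ} {N : TermNetwork k} (h : N.Proper) : N.lift.Proper := by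
  refine ⟨h.two_le, fun e he => ?_⟩
  obtain ⟨e', he', rfl⟩ := List.mem_map.1 he
  exact h.lt_size e' he'

theorem TermNetwork.Proper.bounded {k : ℕ} {N : TermNetwork k} (h : N.Proper) (xs : Fin k → A) :
    ∀ x y t, (x, y, t) ∈ N.triples xs → x < N.size ∧ y < N.size := by
  rintro x y _ ⟨t, ht, rfl⟩
  exact h.lt_size _ ht

/-- The formula `sigma n N v` expresses survival. -/
theorem realize_sigma {n k : ℕ} {N : TermNetwork k} (hN : N.Proper) (v : Tm k) (xs : Fin k → A) :
    (sigma n N v).Realize default xs ↔ Survives n (N.triples xs) (v.eval xs) := by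
  induction n generalizing k N with
  | zero =>
    rw [sigma, realize_bigAnd]
    constructor
    · rintro h _ ⟨t, ht, rfl⟩ hle
      refine h _ (List.mem_map.2 ⟨_, List.mem_filter.2 ⟨ht, by simp⟩, rfl⟩) ?_
      exact (realize_le xs t v).2 hle
    · intro h φ hφ
      obtain ⟨⟨x, y, t⟩, he, rfl⟩ := List.mem_map.1 hφ
      obtain ⟨he, hxy⟩ := List.mem_filter.1 he
      simp only [decide_eq_true_eq] at hxy
      obtain ⟨rfl, rfl⟩ := hxy
      exact fun hle => h _ ⟨t, he, rfl⟩ ((realize_le xs t v).1 hle)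
  | succ n ih =>
    rw [sigma]
    simp only [FirstOrder.Language.BoundedFormula.realize_inf, realize_bigAnd, List.mem_flatMap,
      List.mem_map, List.mem_filter, decide_eq_true_eq]
    rw [Survives]
    have p_eval : ∀ p q : A, (Tm.v ((Fin.last k).castSucc) : Tm (k + 2)).eval
        (Fin.snoc (Fin.snoc xs p : Fin (k + 1) → A) q : Fin (k + 2) → A) = p := fun p q => by
      rw [Tm.eval_v, Fin.snoc_castSucc, Fin.snoc_last]
    have q_eval : ∀ p q : A, (Tm.v (Fin.last (k + 1)) : Tm (k + 2)).eval
        (Fin.snoc (Fin.snoc xs p : Fin (k + 1) → A) q : Fin (k + 2) → A) = q := fun p q => by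
      rw [Tm.eval_v, Fin.snoc_last]
    refine and_congr ?_ (and_congr ?_ ?_)
    · constructor
      · rintro h x y z _ _ ⟨t, ht, rfl⟩ ⟨t', ht', rfl⟩
        have := (ih (hN.add _ _ _) v xs).1
          (h _ ⟨_, ht, _, ⟨ht', rfl⟩, rfl⟩)
        rwa [TermNetwork.triples_add, Tm.eval_comp, compOp_eq_mul] at this
      · rintro h _ ⟨⟨x, y, t⟩, ht, ⟨y', z, t'⟩, ⟨ht', hy⟩, rfl⟩
        simp only at hy
        subst hy
        rw [ih (hN.add _ _ _) v xs, TermNetwork.triples_add, Tm.eval_comp, compOp_eq_mul]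
        exact h _ _ _ _ _ ⟨t, ht, rfl⟩ ⟨t', ht', rfl⟩
    · have key : ∀ (e : ℕ) (p : A × A) (q w : ℕ), (sigma n ((N.lift.add e w (Tm.v ((Fin.last k).castSucc))).add w q
            (Tm.v (Fin.last (k + 1)))) v.lift).Realize default
            (Fin.snoc (Fin.snoc xs p.1 : Fin (k + 1) → A) p.2 : Fin (k + 2) → A) ↔
          Survives n (insert (w, q, p.2) (insert (e, w, p.1) (N.triples xs))) (v.eval xs) := by
        intro e p q w
        rw [ih ((hN.lift.add _ _ _).add _ _ _), TermNetwork.triples_add, TermNetwork.triples_add,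
          TermNetwork.triples_lift, p_eval, q_eval, Tm.eval_lift]
      constructor
      · rintro h x y _ p q ⟨t, ht, rfl⟩ hpq
        have := h _ ⟨_, ht, rfl⟩ p q
        rw [FirstOrder.Language.BoundedFormula.realize_imp, realize_le, Tm.eval_lift,
          Tm.eval_comp, p_eval, q_eval, compOp_eq_mul] at this
        obtain ⟨φ, hφ, h'⟩ := realize_bigOr.1 (this hpq)
        obtain ⟨w, -, rfl⟩ := List.mem_map.1 hφ
        exact ⟨w, (key _ (p, q) _ _).1 h'⟩
      · rintro h _ ⟨⟨x, y, t⟩, ht, rfl⟩ p q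
        rw [FirstOrder.Language.BoundedFormula.realize_imp, realize_le, Tm.eval_lift,
          Tm.eval_comp, p_eval, q_eval, compOp_eq_mul]
        intro hpq
        obtain ⟨w, hw⟩ := h x y _ p q ⟨t, ht, rfl⟩ hpq
        have hxy := hN.lt_size _ ht
        -- `N.size` is the one fresh node in the range of the disjunction; by `Survives.fresh` it
        -- can replace any witness.
        refine realize_bigOr.2 ⟨_, List.mem_map.2 ⟨N.size, by simp, rfl⟩, ?_⟩
        exact (key _ (p, q) _ _).2 (hw.fresh (hN.bounded xs) hN.two_le hxy.1 hxy.2)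
    · have key : ∀ x y i p q, (sigma n (N.lift.add x y (Tm.v i)) v.lift).Realize default
            (Fin.snoc (Fin.snoc xs p : Fin (k + 1) → A) q : Fin (k + 2) → A) ↔
          Survives n (insert (x, y, (Tm.v i).eval (Fin.snoc (Fin.snoc xs p : Fin (k + 1) → A) q :
            Fin (k + 2) → A)) (N.triples xs)) (v.eval xs) := by
        intro x y i p q
        rw [ih (hN.lift.add _ _ _), TermNetwork.triples_add,
          TermNetwork.triples_lift, Tm.eval_lift]
      have rl : ∀ (t : Tm k) (x y : ℕ) (p q : A),
          (((t.lift).le (Tm.join (Tm.v ((Fin.last k).castSucc)) (Tm.v (Fin.last (k + 1))))).imp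
            (sigma n (N.lift.add x y (Tm.v ((Fin.last k).castSucc))) v.lift ⊔
              sigma n (N.lift.add x y (Tm.v (Fin.last (k + 1)))) v.lift)).Realize default
            (Fin.snoc (Fin.snoc xs p : Fin (k + 1) → A) q : Fin (k + 2) → A) ↔
          (t.eval xs ≤ p ⊔ q → Survives n (insert (x, y, p) (N.triples xs)) (v.eval xs) ∨
            Survives n (insert (x, y, q) (N.triples xs)) (v.eval xs)) := by
        intro t x y p q
        rw [FirstOrder.Language.BoundedFormula.realize_imp, realize_le, Tm.eval_lift,
          Tm.eval_join, p_eval, q_eval, joinOp_eq_sup,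
          FirstOrder.Language.BoundedFormula.realize_sup, key, key, p_eval, q_eval]
      constructor
      · rintro h x y _ p q ⟨t, ht, rfl⟩
        exact (rl t x y p q).1 (h _ ⟨_, ht, rfl⟩ p q)
      · rintro h _ ⟨⟨x, y, t⟩, ht, rfl⟩ p q
        exact (rl t x y p q).2 (h x y _ p q ⟨t, ht, rfl⟩)

theorem realize_rho {n : ℕ} :
    A ⊨ rho n ↔ ∀ a b : A, ¬ a ≤ b → Survives n {(0, 1, a)} b := by
  refine forall_congr' fun a => forall_congr' fun b => ?_
  have hp : (TermNetwork.single (Tm.v 0 : Tm 2)).Proper :=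
    ⟨le_rfl, fun e he => by
      obtain rfl := List.mem_singleton.1 he
      exact ⟨Nat.zero_lt_two, Nat.one_lt_two⟩⟩
  rw [FirstOrder.Language.BoundedFormula.realize_imp,
    FirstOrder.Language.BoundedFormula.realize_not]
  set xs : Fin 2 → A := Fin.snoc (Fin.snoc default a : Fin 1 → A) b
  have ha : (Tm.v 0 : Tm 2).eval xs = a := rfl
  have hb : (Tm.v 1 : Tm 2).eval xs = b := rfl
  have ht : (TermNetwork.single (Tm.v 0 : Tm 2)).triples xs = {(0, 1, a)} := by
    ext ⟨x, y, c⟩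
    simp [TermNetwork.mem_triples, TermNetwork.single, and_assoc, ha, eq_comm]
  refine imp_congr (not_congr ?_) ?_
  · exact (realize_le xs _ _).trans (by rw [ha, hb])
  · exact (realize_sigma hp (Tm.v 1) xs).trans (by rw [ht, hb])

theorem realize_rho_iff_hasWinningStrategy {n : ℕ} : A ⊨ rho n ↔ HasWinningStrategy A n :=
  realize_rho.trans hasWinningStrategy_iff_survives.symm

end Sentences

/-! ### Saturated networks and their propositional description -/

/-- An instance of the rules for networks: `(true, (a, b, c), (x, y, z))` stands for the equation
`a ; b = c` and the nodes `x, y, z`, and `(false, (a, b, c), (x, y, z))` for `a + b = c`. -/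
abbrev RuleInstance (N A : Type u) : Type u := Bool × (A × A × A) × (N × N × N)

/-- The labelling `V` obeys the instance of the rules, where `wit x z a b` is the witness for the
product of `a` and `b` on the edge `(x, z)`. -/
def Obeys {N A : Type u} (wit : N → N → A → A → N) (V : N → N → A → Prop) :
    RuleInstance N A → Prop
  | (true, (a, b, c), (x, y, z)) =>
      (V x y a → V y z b → V x z c) ∧
      (V x z c → V x (wit x z a b) a ∧ V (wit x z a b) z b)
  | (false, (a, b, c), (x, y, _)) => V x y c ↔ V x y a ∨ V x y b

/-- The equation of the instance is true. -/
def RuleInstance.IsTrue {N A : Type u} (comp join : A → A → A) : RuleInstance N A → Prop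
  | (true, (a, b, c), _) => comp a b = c
  | (false, (a, b, c), _) => join a b = c

/-- Nodes built from two nodes by adding a witness for each product on each pair of nodes. -/
inductive Node (A : Type u) : Type u
  | src : Node A
  | tgt : Node A
  | wit (x y : Node A) (d e : A) : Node A

section Saturation

variable {A : Type u} (comp join : A → A → A)

/-- The labelling `V` obeys all rules. -/
def Saturated (V : Node A → Node A → A → Prop) : Prop :=
  ∀ i : RuleInstance (Node A) A, i.IsTrue comp join → Obeys Node.wit V i

variable {comp join}

/-- Compactness of propositional logic: the limit, along an ultrafilter on the finite sets of
instances, of labellings that obey these sets. -/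
theorem exists_saturated {a b : A}
    (h : ∀ L : Finset (RuleInstance (Node A) A), ∃ V : Node A → Node A → A → Prop,
      (∀ i ∈ L, i.IsTrue comp join → Obeys Node.wit V i) ∧
      ¬ (V Node.src Node.tgt a ↔ V Node.src Node.tgt b)) :
    ∃ V : Node A → Node A → A → Prop, Saturated comp join V ∧
      ¬ (V Node.src Node.tgt a ↔ V Node.src Node.tgt b) := by
  classical
  choose W hW hab using h
  -- An ultrafilter finer than `atTop` contains, for each instance, the family of finite sets to
  -- which it belongs.
  let U : Ultrafilter (Finset (RuleInstance (Node A) A)) := Ultrafilter.of Filter.atTop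
  have hU : ∀ i : RuleInstance (Node A) A, ∀ᶠ L in (U : Filter (Finset (RuleInstance (Node A) A))),
      i ∈ L := fun i =>
    Ultrafilter.of_le Filter.atTop
      ((Filter.eventually_ge_atTop ({i} : Finset _)).mono fun L hL =>
        hL (Finset.mem_singleton_self i))
  have hiff : ∀ p q : Finset (RuleInstance (Node A) A) → Prop,
      (∀ᶠ L in U, (p L ↔ q L)) ↔ ((∀ᶠ L in U, p L) ↔ ∀ᶠ L in U, q L) := fun p q => by
    simp only [iff_iff_implies_and_implies, Filter.eventually_and, Ultrafilter.eventually_imp]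
  refine ⟨fun x y c => ∀ᶠ L in U, W L x y c, fun i hi => ?_, ?_⟩
  · have key : ∀ᶠ L in U, Obeys Node.wit (W L) i := (hU i).mono fun L hL => hW L i hL hi
    obtain ⟨o, ⟨a, b, c⟩, x, y, z⟩ := i
    cases o
    · simpa only [Obeys, hiff, Ultrafilter.eventually_or] using key
    · simpa only [Obeys, Filter.eventually_and, Ultrafilter.eventually_imp] using key
  · rw [← hiff, ← Ultrafilter.eventually_not]
    exact Filter.Eventually.of_forall hab

/-- Saturated labellings that separate the elements add up to a representation. -/
theorem hasRepresentation_of_saturated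
    (h : ∀ a b : A, a ≠ b → ∃ V : Node A → Node A → A → Prop, Saturated comp join V ∧
      ¬ (V Node.src Node.tgt a ↔ V Node.src Node.tgt b)) :
    HasRepresentation comp join := by
  choose V hV hab using h
  let P : Type u := {p : A × A // p.1 ≠ p.2}
  let W : P → Node A → Node A → A → Prop := fun p => V p.1.1 p.1.2 p.2
  have hW : ∀ p, Saturated comp join (W p) := fun p => hV _ _ _
  -- The base is the disjoint union of the labellings. The extra point `none` lies on no edge and
  -- keeps the base non-empty when there are no two distinct elements.
  refine ⟨Option (P × Node A), ⟨none⟩,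
    fun c => {q | ∃ p x y, q = (some (p, x), some (p, y)) ∧ W p x y c}, ?_, ?_, ?_⟩
  · intro a b heq
    by_contra hne
    have hmem : ∀ c, W ⟨(a, b), hne⟩ Node.src Node.tgt c ↔
        ((some (⟨(a, b), hne⟩, Node.src), some (⟨(a, b), hne⟩, Node.tgt)) :
          Option (P × Node A) × Option (P × Node A)) ∈
          {q : Option (P × Node A) × Option (P × Node A) |
            ∃ p x y, q = (some (p, x), some (p, y)) ∧ W p x y c} := by
      intro c
      constructor
      · exact fun h => ⟨_, _, _, rfl, h⟩
      · rintro ⟨p, x, y, h, h'⟩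
        simp only [Prod.mk.injEq, Option.some.injEq] at h
        obtain ⟨⟨rfl, rfl⟩, -, rfl⟩ := h
        exact h'
    refine hab a b hne ((hmem a).trans (Iff.trans ?_ (hmem b).symm))
    exact Iff.of_eq (congrArg (_ ∈ ·) heq)
  · intro a b
    ext q
    constructor
    · rintro ⟨p, x, y, rfl, h⟩
      -- The third node of a join instance plays no role, so any node will do.
      rcases (hW p (false, (a, b, join a b), (x, y, x)) rfl).1 h with h | h
      · exact Or.inl ⟨p, x, y, rfl, h⟩
      · exact Or.inr ⟨p, x, y, rfl, h⟩
    · rintro (⟨p, x, y, rfl, h⟩ | ⟨p, x, y, rfl, h⟩)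
      · exact ⟨p, x, y, rfl, (hW p (false, (a, b, join a b), (x, y, x)) rfl).2 (Or.inl h)⟩
      · exact ⟨p, x, y, rfl, (hW p (false, (a, b, join a b), (x, y, x)) rfl).2 (Or.inr h)⟩
  · intro a b
    ext q
    constructor
    · rintro ⟨p, x, z, rfl, h⟩
      obtain ⟨h1, h2⟩ := (hW p (true, (a, b, comp a b), (x, x, z)) rfl).2 h
      exact ⟨some (p, Node.wit x z a b), ⟨p, _, _, rfl, h1⟩, ⟨p, _, _, rfl, h2⟩⟩
    · obtain ⟨q1, q2⟩ := q
      rintro ⟨r, ⟨p, x, y, h1, h⟩, ⟨p', y', z, h2, h'⟩⟩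
      simp only [Prod.mk.injEq] at h1 h2
      obtain ⟨rfl, rfl⟩ := h1
      -- The shared middle point carries its index, so both edges belong to the same labelling.
      simp only [Option.some.injEq, Prod.mk.injEq] at h2
      obtain ⟨⟨rfl, rfl⟩, rfl⟩ := h2
      exact ⟨p, x, z, rfl, (hW p (true, (a, b, comp a b), (x, y, z)) rfl).1 h h'⟩

theorem hasRepresentation_of_finitely_satisfiable
    (h : ∀ a b : A, a ≠ b → ∀ L : Finset (RuleInstance (Node A) A),
      ∃ V : Node A → Node A → A → Prop,
        (∀ i ∈ L, i.IsTrue comp join → Obeys Node.wit V i) ∧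
        ¬ (V Node.src Node.tgt a ↔ V Node.src Node.tgt b)) :
    HasRepresentation comp join :=
  hasRepresentation_of_saturated fun a b hab => exists_saturated (h a b hab)

end Saturation

/-! ### From survival to obedient labellings -/

section PlayingTheRules

variable {A : Type u}

/-- The facts that may have to be added to obey an instance of the rules. -/
def RuleInstance.conclusions : RuleInstance (Node A) A → Set (Node A × Node A × A)
  | (_, (a, b, c), (x, y, z)) =>
      {(x, z, c), (x, Node.wit x z a b, a), (Node.wit x z a b, z, b), (x, y, a), (x, y, b),
        (x, y, c)}

theorem RuleInstance.finite_conclusions (i : RuleInstance (Node A) A) : i.conclusions.Finite := by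
  obtain ⟨o, ⟨a, b, c⟩, x, y, z⟩ := i
  simp only [RuleInstance.conclusions, Set.finite_insert, Set.finite_singleton]

/-- The node `u` occurs in the set `S` of facts. -/
def Occurs (S : Set (Node A × Node A × A)) (u : Node A) : Prop :=
  ∃ v c, (u, v, c) ∈ S ∨ (v, u, c) ∈ S

/-- Witness nodes occur only together with what they witness. -/
def WitnessClosed (S : Set (Node A × Node A × A)) : Prop :=
  ∀ x y d e, Occurs S (Node.wit x y d e) →
    (x, Node.wit x y d e, d) ∈ S ∧ (Node.wit x y d e, y, e) ∈ S

theorem Occurs.of_insert {S : Set (Node A × Node A × A)} {x y u : Node A} {c : A}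
    (h : Occurs (insert (x, y, c) S) u) : u = x ∨ u = y ∨ Occurs S u := by
  obtain ⟨v, d, h | h⟩ := h <;> rcases h with h | h
  · simp only [Prod.mk.injEq] at h
    exact Or.inl h.1
  · exact Or.inr (Or.inr ⟨v, d, Or.inl h⟩)
  · simp only [Prod.mk.injEq] at h
    exact Or.inr (Or.inl h.2.1)
  · exact Or.inr (Or.inr ⟨v, d, Or.inr h⟩)

/-- A fact between nodes that occur already brings in no new witness node. -/
theorem WitnessClosed.insert {S : Set (Node A × Node A × A)} (hS : WitnessClosed S) {x y : Node A}
    (hx : Occurs S x) (hy : Occurs S y) (c : A) : WitnessClosed (insert (x, y, c) S) := by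
  intro u v d e h
  have : Occurs S (Node.wit u v d e) := by
    rcases h.of_insert with h | h | h
    · rwa [h]
    · rwa [h]
    · exact h
  exact ⟨Or.inr (hS u v d e this).1, Or.inr (hS u v d e this).2⟩

/-- The network that is obtained by renaming the nodes. -/
def rename (f : Node A → ℕ) (e : Node A × Node A × A) : ℕ × ℕ × A := (f e.1, f e.2.1, e.2.2)

theorem mem_image_rename {f : Node A → ℕ} {S : Set (Node A × Node A × A)} {x y : Node A} {c : A}
    (h : (x, y, c) ∈ S) : (f x, f y, c) ∈ rename f '' S := ⟨_, h, rfl⟩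

theorem image_rename_insert (f : Node A → ℕ) (S : Set (Node A × Node A × A)) (x y : Node A)
    (c : A) : rename f '' insert (x, y, c) S = insert (f x, f y, c) (rename f '' S) :=
  Set.image_insert_eq

-- A node that does not occur yet may be given any number, in particular the witness that `∃` is
-- going to choose for it.
open Classical in
theorem image_rename_update (f : Node A → ℕ) {S : Set (Node A × Node A × A)} {u : Node A}
    (hu : ¬ Occurs S u) (n : ℕ) : rename (Function.update f u n) '' S = rename f '' S := by
  refine Set.image_congr ?_
  rintro ⟨x, y, c⟩ h
  have hx : x ≠ u := fun hx => hu ⟨y, c, Or.inl (hx ▸ h)⟩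
  have hy : y ≠ u := fun hy => hu ⟨x, c, Or.inr (hy ▸ h)⟩
  simp only [rename, Function.update_of_ne hx, Function.update_of_ne hy]

theorem ncard_diff_insert_lt {α : Type*} {F S : Set α} (hF : F.Finite) {e : α} (he : e ∈ F)
    (heS : e ∉ S) : (F \ insert e S).ncard < (F \ S).ncard := by
  refine Set.ncard_lt_ncard ⟨Set.sdiff_subset_sdiff_right (Set.subset_insert _ _), fun h => ?_⟩
    (hF.subset Set.sdiff_subset)
  exact (h ⟨he, heS⟩).2 (Or.inl rfl)

theorem ncard_diff_insert_le {α : Type*} {F S : Set α} (hF : F.Finite) (e : α) :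
    (F \ insert e S).ncard ≤ (F \ S).ncard :=
  Set.ncard_le_ncard (Set.sdiff_subset_sdiff_right (Set.subset_insert _ _))
    (hF.subset Set.sdiff_subset)

variable [JoinSemilatticeOrderedSemigroup A]

/-- By surviving long enough `∃` builds a labelling that obeys a given finite set of instances. -/
theorem Survives.exists_labelling {L : Set (RuleInstance (Node A) A)} {b : A}
    {F : Set (Node A × Node A × A)} (hF : F.Finite) (hLF : ∀ i ∈ L, i.conclusions ⊆ F)
    (n : ℕ) (S : Set (Node A × Node A × A)) (f : Node A → ℕ) (hf0 : f Node.src = 0)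
    (hf1 : f Node.tgt = 1) (hS : WitnessClosed S) (hn : (F \ S).ncard ≤ n)
    (hs : Survives n (rename f '' S) b) :
    ∃ V : Set (Node A × Node A × A), S ⊆ V ∧ (Node.src, Node.tgt, b) ∉ V ∧
      ∀ i ∈ L, i.IsTrue (fun a b : A => a * b) (fun a b : A => a ⊔ b) →
        Obeys Node.wit (fun x y c => (x, y, c) ∈ V) i := by
  classical
  -- The number of rounds bounds the number of facts of `F` still missing from `S`; every round
  -- lowers the latter.
  induction n using Nat.strong_induction_on generalizing S f with
  | _ n ih =>
  by_cases hall : ∀ i ∈ L, i.IsTrue (fun a b : A => a * b) (fun a b : A => a ⊔ b) →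
      Obeys Node.wit (fun x y c => (x, y, c) ∈ S) i
  · refine ⟨S, subset_rfl, fun hb => hs.zero b ?_ le_rfl, hall⟩
    have := mem_image_rename (f := f) hb
    rwa [hf0, hf1] at this
  push Not at hall
  obtain ⟨i, hi, hit, hio⟩ := hall
  have hiF := hLF i hi
  obtain ⟨o, ⟨a, b', c⟩, x, y, z⟩ := i
  -- adding one fact about nodes that occur already
  have step : ∀ u v d, (u, v, d) ∈ F → (u, v, d) ∉ S → Occurs S u → Occurs S v →
      (∀ m, n = m + 1 → Survives m (insert (f u, f v, d) (rename f '' S)) b) →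
      ∃ V : Set (Node A × Node A × A), S ⊆ V ∧ (Node.src, Node.tgt, b) ∉ V ∧
      ∀ i ∈ L, i.IsTrue (fun a b : A => a * b) (fun a b : A => a ⊔ b) →
        Obeys Node.wit (fun x y c => (x, y, c) ∈ V) i := by
    intro u v d hF' hS' hu hv hm
    have hlt := ncard_diff_insert_lt hF hF' hS'
    obtain ⟨m, rfl⟩ : ∃ m, n = m + 1 := ⟨n - 1, by omega⟩
    obtain ⟨V, h1, h2, h3⟩ := ih m (Nat.lt_succ_self m) (insert (u, v, d) S) f hf0 hf1
      (hS.insert hu hv d) (by omega) (by rw [image_rename_insert]; exact hm m rfl)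
    exact ⟨V, (Set.subset_insert _ _).trans h1, h2, h3⟩
  cases o
  · obtain rfl : a ⊔ b' = c := hit
    have hio : ¬ ((x, y, a ⊔ b') ∈ S ↔ (x, y, a) ∈ S ∨ (x, y, b') ∈ S) := hio
    -- A join move with both alternatives equal to `a ⊔ b'` leaves no choice, so it can be used to
    -- close a label upwards.
    have up : ∀ t, t ≤ a ⊔ b' → (x, y, t) ∈ S → (x, y, a ⊔ b') ∉ S →
        ∃ V : Set (Node A × Node A × A), S ⊆ V ∧ (Node.src, Node.tgt, b) ∉ V ∧
        ∀ i ∈ L, i.IsTrue (fun a b : A => a * b) (fun a b : A => a ⊔ b) →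
          Obeys Node.wit (fun x y c => (x, y, c) ∈ V) i := by
      intro t ht hts hn
      refine step x y (a ⊔ b') (hiF (by simp [RuleInstance.conclusions])) hn
        ⟨_, _, Or.inl hts⟩ ⟨_, _, Or.inr hts⟩ ?_
      rintro m rfl
      simpa using hs.2.2 _ _ _ (a ⊔ b') (a ⊔ b') (mem_image_rename hts) (ht.trans le_sup_left)
    by_cases hc : (x, y, a ⊔ b') ∈ S
    · have ha : (x, y, a) ∉ S := fun h => hio ⟨fun _ => Or.inl h, fun _ => hc⟩
      have hb : (x, y, b') ∉ S := fun h => hio ⟨fun _ => Or.inr h, fun _ => hc⟩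
      have hpos : 0 < (F \ S).ncard := lt_of_le_of_lt (Nat.zero_le _)
        (ncard_diff_insert_lt hF (hiF (by simp [RuleInstance.conclusions])) ha)
      obtain ⟨m, rfl⟩ : ∃ m, n = m + 1 := ⟨n - 1, by omega⟩
      rcases hs.2.2 _ _ _ a b' (mem_image_rename hc) le_rfl with h | h
      · exact step x y a (hiF (by simp [RuleInstance.conclusions])) ha
          ⟨_, _, Or.inl hc⟩ ⟨_, _, Or.inr hc⟩ (fun k hk => by
            obtain rfl : m = k := by omega
            exact h)
      · exact step x y b' (hiF (by simp [RuleInstance.conclusions])) hb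
          ⟨_, _, Or.inl hc⟩ ⟨_, _, Or.inr hc⟩ (fun k hk => by
            obtain rfl : m = k := by omega
            exact h)
    · have : (x, y, a) ∈ S ∨ (x, y, b') ∈ S := by
        by_contra h
        exact hio ⟨fun h' => absurd h' hc, fun h' => absurd h' h⟩
      rcases this with h | h
      · exact up a le_sup_left h hc
      · exact up b' le_sup_right h hc
  · obtain rfl : a * b' = c := hit
    set w := Node.wit x z a b' with hw
    have hio : ¬ (((x, y, a) ∈ S → (y, z, b') ∈ S → (x, z, a * b') ∈ S) ∧
      ((x, z, a * b') ∈ S → (x, w, a) ∈ S ∧ (w, z, b') ∈ S)) := hio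
    rw [not_and_or] at hio
    rcases hio with hio | hio
    · push Not at hio
      obtain ⟨h1, h2, h3⟩ := hio
      refine step x z (a * b') (hiF (by simp [RuleInstance.conclusions])) h3
        ⟨_, _, Or.inl h1⟩ ⟨_, _, Or.inr h2⟩ ?_
      rintro m rfl
      exact hs.1 _ _ _ _ _ (mem_image_rename h1) (mem_image_rename h2)
    · rw [Classical.not_imp] at hio
      obtain ⟨hc, hio⟩ := hio
      -- If `w` occurred, witness closure would already supply both required facts.
      have hwo : ¬ Occurs S w := fun h => hio (hS _ _ _ _ h)
      have hxo : Occurs S x := ⟨_, _, Or.inl hc⟩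
      have hzo : Occurs S z := ⟨_, _, Or.inr hc⟩
      have hxw : x ≠ w := fun h => hwo (h ▸ hxo)
      have hzw : z ≠ w := fun h => hwo (h ▸ hzo)
      -- This round adds two facts. The first lowers the number of missing facts, and the second
      -- cannot raise it.
      have hlt := ncard_diff_insert_lt (S := S) hF
        (hiF (show (x, w, a) ∈ _ by simp [RuleInstance.conclusions, hw]))
        (fun h => hwo ⟨_, _, Or.inr h⟩)
      have hle := ncard_diff_insert_le (S := insert (x, w, a) S) hF (w, z, b')
      obtain ⟨m, rfl⟩ : ∃ m, n = m + 1 := ⟨n - 1, by omega⟩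
      obtain ⟨k, hk⟩ := hs.2.1 _ _ _ a b' (mem_image_rename hc) le_rfl
      -- The new node `w` gets the number `k` of the node chosen by `∃`, which may be old: the
      -- numbering need not be injective.
      obtain ⟨V, h1, h2, h3⟩ := ih m (Nat.lt_succ_self m)
        (insert (w, z, b') (insert (x, w, a) S)) (Function.update f w k)
        (by rw [Function.update_of_ne (by simp [hw]), hf0])
        (by rw [Function.update_of_ne (by simp [hw]), hf1])
        (by
          intro x' y' d e h
          rcases h.of_insert with h | h | h
          · rw [hw, Node.wit.injEq] at h
            obtain ⟨rfl, rfl, rfl, rfl⟩ := h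
            exact ⟨Or.inr (Or.inl rfl), Or.inl rfl⟩
          · rw [← h] at hzo
            exact ⟨Or.inr (Or.inr (hS _ _ _ _ hzo).1), Or.inr (Or.inr (hS _ _ _ _ hzo).2)⟩
          · rcases h.of_insert with h | h | h
            · rw [← h] at hxo
              exact ⟨Or.inr (Or.inr (hS _ _ _ _ hxo).1), Or.inr (Or.inr (hS _ _ _ _ hxo).2)⟩
            · rw [hw, Node.wit.injEq] at h
              obtain ⟨rfl, rfl, rfl, rfl⟩ := h
              exact ⟨Or.inr (Or.inl rfl), Or.inl rfl⟩
            · exact ⟨Or.inr (Or.inr (hS _ _ _ _ h).1), Or.inr (Or.inr (hS _ _ _ _ h).2)⟩)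
        (by omega)
        (by
          rw [image_rename_insert, image_rename_insert, image_rename_update f hwo,
            Function.update_self, Function.update_of_ne hxw, Function.update_of_ne hzw]
          exact hk)
      exact ⟨V, ((Set.subset_insert _ _).trans (Set.subset_insert _ _)).trans h1, h2, h3⟩

/-- If `∃` survives arbitrarily long, then the algebra is representable. -/
theorem representable_of_survives
    (h : ∀ n, ∀ a b : A, ¬ a ≤ b → Survives n {(0, 1, a)} b) : Representable A := by
  classical
  have key : ∀ a b : A, ¬ a ≤ b → ∀ L : Finset (RuleInstance (Node A) A),
      ∃ V : Node A → Node A → A → Prop,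
        (∀ i ∈ L, i.IsTrue (fun a b : A => a * b) (fun a b : A => a ⊔ b) → Obeys Node.wit V i) ∧
        V Node.src Node.tgt a ∧ ¬ V Node.src Node.tgt b := by
    intro a b hab L
    -- The conclusions of the instances in `L` are all the facts that will ever be added.
    have hF : (⋃ i ∈ L, i.conclusions).Finite :=
      L.finite_toSet.biUnion fun i _ => i.finite_conclusions
    obtain ⟨V, h1, h2, h3⟩ := Survives.exists_labelling (L := (L : Set _)) hF
      (fun i hi => Set.subset_biUnion_of_mem (u := fun i => RuleInstance.conclusions i) hi)
      _ {(Node.src, Node.tgt, a)}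
      (fun u => match u with | .tgt => 1 | _ => 0) rfl rfl
      (by
        rintro x y d e ⟨v, c, h | h⟩ <;> simp at h)
      le_rfl
      (by
        rw [Set.image_singleton]
        exact h _ a b hab)
    exact ⟨_, h3, h1 rfl, h2⟩
  refine hasRepresentation_of_finitely_satisfiable fun a b hab L => ?_
  -- Distinct elements fail to be comparable in at least one direction, and the game is played in
  -- that direction.
  by_cases hle : a ≤ b
  · obtain ⟨V, h1, h2, h3⟩ := key b a (fun h => hab (le_antisymm hle h)) L
    exact ⟨V, h1, fun h => h3 (h.2 h2)⟩
  · obtain ⟨V, h1, h2, h3⟩ := key a b hle L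
    exact ⟨V, h1, fun h => h3 (h.1 h2)⟩

theorem survives_of_representable (h : Representable A) (n : ℕ) (a b : A) (hab : ¬ a ≤ b) :
    Survives n {(0, 1, a)} b := by
  obtain ⟨D, _, R, hR⟩ := h
  -- Inclusion would give `a ⊔ b` and `b` the same relation, so injectivity makes a representation
  -- reflect the order.
  have : ¬ R a ⊆ R b := fun hs => hab (by
    rw [← sup_eq_right]
    refine hR.injective ?_
    rw [hR.map_join a b]
    exact Set.union_eq_right.2 hs)
  obtain ⟨⟨p, q⟩, hp, hq⟩ := Set.not_subset.1 this
  refine survives_of_representation hR (h := fun i => if i = 0 then p else q) ⟨2, ?_⟩ ?_ hq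
  · rintro x y t h
    simp only [Set.mem_singleton_iff, Prod.mk.injEq] at h
    omega
  · rintro x y t h
    simp only [Set.mem_singleton_iff, Prod.mk.injEq] at h
    obtain ⟨rfl, rfl, rfl⟩ := h
    exact hp

theorem representable_iff_realize_rho : Representable A ↔ ∀ n, A ⊨ rho n := by
  simp only [realize_rho]
  exact ⟨fun h n a b hab => survives_of_representable h n a b hab, representable_of_survives⟩

end PlayingTheRules

/-! ### A universal axiomatisation -/

section Transport

universe v w

variable {N : Type v} {A : Type v} {N' A' : Type w}

/-- Rename the nodes and the labels of an instance. -/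
def RuleInstance.map (g : N → N') (e : A → A') : RuleInstance N A → RuleInstance N' A'
  | (o, (a, b, c), (x, y, z)) => (o, (e a, e b, e c), (g x, g y, g z))

/-- Labellings are pulled back along renamings that commute with witnesses; neither renaming has to
be injective. -/
theorem obeys_map {wit : N → N → A → A → N} {wit' : N' → N' → A' → A' → N'} {g : N → N'}
    {e : A → A'} (h : ∀ x y a b, g (wit x y a b) = wit' (g x) (g y) (e a) (e b))
    (V : N' → N' → A' → Prop) (i : RuleInstance N A) :
    Obeys wit' V (i.map g e) ↔ Obeys wit (fun x y c => V (g x) (g y) (e c)) i := by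
  obtain ⟨o, ⟨a, b, c⟩, x, y, z⟩ := i
  cases o
  · rfl
  · simp only [RuleInstance.map, Obeys, h]

end Transport

/-- The witness nodes over natural numbers. -/
def natWit (x y a b : ℕ) : ℕ := Nat.pair (Nat.pair x y) (Nat.pair a b) + 2

/-- Every labelling that obeys the instances in `L` treats the labels `0` and `1` alike on the pair
`(0, 1)`. -/
def Identifies (L : List (RuleInstance ℕ ℕ)) : Prop :=
  ∀ V : ℕ → ℕ → ℕ → Prop, (∀ i ∈ L, Obeys natWit V i) → (V 0 1 0 ↔ V 0 1 1)

/-- The variable whose index is the residue of `i`. -/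
def modVar (k i : ℕ) : Tm (k + 2) := Tm.v ⟨i % (k + 2), Nat.mod_lt _ (Nat.succ_pos _)⟩

/-- The equation of an instance, as a formula. -/
def RuleInstance.equation (k : ℕ) : RuleInstance ℕ ℕ → Fm (k + 2)
  | (true, (a, b, c), _) => (Tm.comp (modVar k a) (modVar k b)).bdEqual (modVar k c)
  | (false, (a, b, c), _) => (Tm.join (modVar k a) (modVar k b)).bdEqual (modVar k c)

/-- The formula saying that the equations of the instances in `L` imply that the first two variables
are equal. -/
def identificationMatrix (k : ℕ) (L : List (RuleInstance ℕ ℕ)) : Fm (k + 2) :=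
  L.foldr (fun i φ => (i.equation k).imp φ) ((modVar k 0).bdEqual (modVar k 1))

/-- The universal closure of `identificationMatrix`. -/
def identification (k : ℕ) (L : List (RuleInstance ℕ ℕ)) : sig.Sentence :=
  (identificationMatrix k L).alls

/-- The universal sentences that express representability. -/
def representabilityTheory : sig.Theory :=
  {φ | ∃ k L, Identifies L ∧ identification k L = φ}

theorem isUniversal_alls {n : ℕ} {φ : Fm n} (h : φ.IsUniversal) :
    FirstOrder.Language.BoundedFormula.IsUniversal (n := 0) φ.alls := by
  induction n with
  | zero => exact h
  | succ n ih => exact ih h.all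

theorem isQF_identificationMatrix (k : ℕ) (L : List (RuleInstance ℕ ℕ)) :
    (identificationMatrix k L).IsQF := by
  induction L with
  | nil => exact (FirstOrder.Language.BoundedFormula.IsAtomic.equal _ _).isQF
  | cons i L ih =>
    refine FirstOrder.Language.BoundedFormula.IsQF.imp ?_ ih
    obtain ⟨o, ⟨a, b, c⟩, x, y, z⟩ := i
    cases o <;> exact (FirstOrder.Language.BoundedFormula.IsAtomic.equal _ _).isQF

theorem isUniversal_of_mem_representabilityTheory {φ : sig.Sentence}
    (h : φ ∈ representabilityTheory) : φ.IsUniversal := by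
  obtain ⟨k, L, -, rfl⟩ := h
  exact isUniversal_alls (isQF_identificationMatrix k L).isUniversal

open Classical in
/-- A point between `x` and `y` along the relations `r` and `s`, if there is one. -/
noncomputable def midpoint {D : Type u} (default : D) (r s : SetRel D D) (x y : D) : D :=
  if h : ∃ d, (x, d) ∈ r ∧ (d, y) ∈ s then h.choose else default

theorem midpoint_spec {D : Type u} {default : D} {r s : SetRel D D} {x y : D}
    (h : ∃ d, (x, d) ∈ r ∧ (d, y) ∈ s) :
    (x, midpoint default r s x y) ∈ r ∧ (midpoint default r s x y, y) ∈ s := by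
  rw [midpoint, dif_pos h]
  exact h.choose_spec

/-- Realise the nodes by points of a representation. -/
noncomputable def realizeNode {M D : Type u} (R : M → SetRel D D) (e : ℕ → M) (p q : D) : ℕ → D
  | 0 => p
  | 1 => q
  | n + 2 =>
      midpoint p (R (e n.unpair.2.unpair.1)) (R (e n.unpair.2.unpair.2))
        (realizeNode R e p q n.unpair.1.unpair.1) (realizeNode R e p q n.unpair.1.unpair.2)
  decreasing_by
    · exact Nat.lt_succ_of_lt (Nat.lt_succ_of_le
        ((Nat.unpair_left_le _).trans (Nat.unpair_left_le _)))
    · exact Nat.lt_succ_of_lt (Nat.lt_succ_of_le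
        ((Nat.unpair_right_le _).trans (Nat.unpair_left_le _)))

theorem realizeNode_natWit {M D : Type u} {R : M → SetRel D D} {e : ℕ → M} {p q : D} {x y a b : ℕ}
    (h : ∃ d, (realizeNode R e p q x, d) ∈ R (e a) ∧ (d, realizeNode R e p q y) ∈ R (e b)) :
    (realizeNode R e p q x, realizeNode R e p q (natWit x y a b)) ∈ R (e a) ∧
      (realizeNode R e p q (natWit x y a b), realizeNode R e p q y) ∈ R (e b) := by
  have : realizeNode R e p q (natWit x y a b) =
      midpoint p (R (e a)) (R (e b)) (realizeNode R e p q x) (realizeNode R e p q y) := by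
    rw [natWit, realizeNode]
    simp only [Nat.unpair_pair]
  rw [this]
  exact midpoint_spec h

section Models

variable {M : Type u} [sig.Structure M]

/-- The truth of an instance ignores its nodes, so they are collapsed to one point, taken in the
universe of `M`. -/
theorem realize_equation {k : ℕ} (xs : Fin (k + 2) → M) (i : RuleInstance ℕ ℕ) :
    (i.equation k).Realize default xs ↔
      (i.map (fun _ => PUnit.unit) (fun j => (modVar k j).eval xs)).IsTrue compOp joinOp := by
  obtain ⟨o, ⟨a, b, c⟩, x, y, z⟩ := i
  cases o
  · exact (Iff.of_eq (congrArg (· = (modVar k c).eval xs) (Tm.eval_join xs _ _)))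
  · exact (Iff.of_eq (congrArg (· = (modVar k c).eval xs) (Tm.eval_comp xs _ _)))

theorem realize_identification {k : ℕ} {L : List (RuleInstance ℕ ℕ)} :
    M ⊨ identification k L ↔ ∀ xs : Fin (k + 2) → M,
      (∀ i ∈ L, (i.map (fun _ => PUnit.unit) (fun j => (modVar k j).eval xs)).IsTrue
        compOp joinOp) → xs 0 = xs 1 := by
  refine FirstOrder.Language.BoundedFormula.realize_alls.trans (forall_congr' fun xs => ?_)
  rw [identificationMatrix]
  induction L with
  | nil =>
    simp only [List.foldr_nil, List.not_mem_nil, false_imp_iff, implies_true, true_imp_iff]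
    have h0 : (modVar k 0).eval xs = xs 0 := rfl
    have h1 : (modVar k 1).eval xs = xs 1 := by
      rw [modVar, Tm.eval_v]
      congr 1
    rw [← h0, ← h1]
    rfl
  | cons i L ih =>
    rw [List.foldr_cons, FirstOrder.Language.BoundedFormula.realize_imp, ih, List.forall_mem_cons,
      and_imp]
    exact imp_congr_left (realize_equation xs i)

/-- For any two points `p`, `q`, the representation induces a labelling of the numerical nodes, with
`0` at `p`, `1` at `q` and midpoints as witnesses. It obeys every instance whose equation holds, so
the two elements relate the same pairs of points and are equal by injectivity. -/
theorem realize_representabilityTheory_of_rClass (h : RClass M) : M ⊨ representabilityTheory := by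
  obtain ⟨D, -, R, hR⟩ := h
  refine (FirstOrder.Language.Theory.model_iff _).2 ?_
  rintro _ ⟨k, L, hL, rfl⟩
  refine realize_identification.2 fun xs hxs => ?_
  set e : ℕ → M := fun j => (modVar k j).eval xs with he
  have h0 : e 0 = xs 0 := rfl
  have h1 : e 1 = xs 1 := by
    rw [he]
    simp only
    rw [modVar, Tm.eval_v]
    congr 1
  rw [← h0, ← h1]
  refine hR.injective (Set.ext ?_)
  rintro ⟨p, q⟩
  have := hL (fun x y c => (realizeNode R e p q x, realizeNode R e p q y) ∈ R (e c)) ?_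
  · rwa [realizeNode, realizeNode] at this
  · rintro ⟨o, ⟨a, b, c⟩, x, y, z⟩ hi
    have ht := hxs _ hi
    cases o
    · have ht : joinOp (e a) (e b) = e c := ht
      change _ ∈ R (e c) ↔ _ ∈ R (e a) ∨ _ ∈ R (e b)
      rw [← ht, hR.map_join]
      rfl
    · have ht : compOp (e a) (e b) = e c := ht
      refine ⟨fun h h' => ?_, fun h => ?_⟩
      · change _ ∈ R (e c)
        rw [← ht, hR.map_comp]
        exact ⟨_, h, h'⟩
      · change _ ∈ R (e c) at h
        rw [← ht, hR.map_comp] at h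
        exact realizeNode_natWit h

/-- Code the nodes by numbers, given a code for the labels. -/
def codeNode (e : M → ℕ) : Node M → ℕ
  | .src => 0
  | .tgt => 1
  | .wit x y a b => natWit (codeNode e x) (codeNode e y) (e a) (e b)

/-- If some finite `L` cannot be obeyed while separating `a` from `b`, then the true equations of
`L`, written with variables, form an axiom that forces `a = b`. -/
theorem rClass_of_realize_representabilityTheory (h : M ⊨ representabilityTheory) : RClass M := by
  classical
  refine hasRepresentation_of_finitely_satisfiable fun a b hab L => ?_
  by_contra hno
  push Not at hno
  let L' := (L.filter fun i => i.IsTrue compOp joinOp).toList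
  let rest : List M := L'.flatMap fun i => [i.2.1.1, i.2.1.2.1, i.2.1.2.2]
  -- With `a` and `b` in front their codes are `0` and `1`. Elements outside `l` all share one code,
  -- which is harmless because labellings are only pulled back along `e`.
  let l : List M := a :: b :: rest
  let e : M → ℕ := fun x => l.idxOf x
  let k := rest.length
  have hl : k + 2 = l.length := rfl
  let xs : Fin (k + 2) → M := fun j => l.get (Fin.cast hl j)
  have he0 : e a = 0 := List.idxOf_cons_self
  have he1 : e b = 1 := by
    simp only [e, l]
    rw [List.idxOf_cons_ne _ hab, List.idxOf_cons_self]
  have hxe : ∀ x ∈ l, (modVar k (e x)).eval xs = x := by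
    intro x hx
    have hlt : e x < l.length := List.idxOf_lt_length_of_mem hx
    have hmod : e x % (k + 2) = e x := Nat.mod_eq_of_lt hlt
    rw [modVar, Tm.eval_v]
    simp only [xs, List.get_eq_getElem, Fin.val_cast, hmod]
    exact List.getElem_idxOf hlt
  -- A numerical labelling that obeys the coded instances pulls back to one on `Node M` that obeys
  -- the true instances of `L`.
  have hid : Identifies (L'.map fun i => i.map (codeNode e) e) := by
    intro V hV
    have := hno (fun x y c => V (codeNode e x) (codeNode e y) (e c)) fun i hi hit =>
      (obeys_map (wit' := natWit) (g := codeNode e) (e := e) (fun _ _ _ _ => rfl) V i).1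
        (hV _ (List.mem_map.2 ⟨i, Finset.mem_toList.2 (Finset.mem_filter.2 ⟨hi, hit⟩), rfl⟩))
    rwa [he0, he1] at this
  have hxs := realize_identification.1
    (FirstOrder.Language.Theory.realize_sentence_of_mem representabilityTheory
      (show identification k _ ∈ representabilityTheory from ⟨k, _, hid, rfl⟩)) xs ?_
  · exact hab hxs
  · intro j hj
    obtain ⟨i, hi, rfl⟩ := List.mem_map.1 hj
    have hit := (Finset.mem_filter.1 (Finset.mem_toList.1 hi)).2
    have hmem : ∀ x ∈ [i.2.1.1, i.2.1.2.1, i.2.1.2.2], x ∈ l := fun x hx =>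
      List.mem_cons_of_mem _ (List.mem_cons_of_mem _ (List.mem_flatMap.2 ⟨i, hi, hx⟩))
    obtain ⟨o, ⟨a', b', c'⟩, x, y, z⟩ := i
    have ha := hxe a' (hmem a' (by simp))
    have hb := hxe b' (hmem b' (by simp))
    have hc := hxe c' (hmem c' (by simp))
    cases o <;> simp only [RuleInstance.map, RuleInstance.IsTrue, ha, hb, hc] <;> exact hit

theorem rClass_iff_realize_representabilityTheory : RClass M ↔ M ⊨ representabilityTheory :=
  ⟨realize_representabilityTheory_of_rClass, rClass_of_realize_representabilityTheory⟩

end Models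

/-! ### Recursive enumerability -/

/-- Run an unbounded search over the codes of possible witnesses `b`. -/
theorem rePred_exists_of_primrecRel {α β : Type} [Primcodable α] [Primcodable β] {p : α → β → Prop}
    (hp : PrimrecRel p) : REPred fun a => ∃ b, p a b := by
  classical
  have hf : Primrec₂ fun (a : α) (n : ℕ) =>
      (Encodable.decode (α := β) n).bind fun b => Option.guard (fun b => p a b) b := by
    refine Primrec.option_bind (Primrec.decode.comp Primrec.snd) ?_
    refine Primrec.option_guard (p := fun (q : (α × ℕ) × β) b => p q.1.1 b) ?_ Primrec.snd
    exact hp.comp (Primrec.fst.comp (Primrec.fst.comp Primrec.fst)) Primrec.snd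
  refine (Partrec.rfindOpt hf.to_comp).dom_re.of_eq fun a => ?_
  rw [Nat.rfindOpt_dom]
  constructor
  · rintro ⟨n, b, hb⟩
    obtain ⟨b', -, h⟩ := Option.bind_eq_some_iff.1 hb
    exact ⟨b', by simpa using (Option.guard_eq_some_iff.1 h).2⟩
  · rintro ⟨b, hb⟩
    refine ⟨Encodable.encode b, b, ?_⟩
    simp [Encodable.encodek, Option.guard, hb]

theorem primrec_pow : Primrec₂ ((· ^ ·) : ℕ → ℕ → ℕ) := Primrec₂.unpaired'.1 Nat.Primrec.pow

/-- The labelling whose characteristic function is given by the binary digits of `m`. -/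
def bitLabelling (m x y c : ℕ) : Prop := m / 2 ^ Nat.pair (Nat.pair x y) c % 2 = 1

theorem bitLabelling_iff_testBit {m x y c : ℕ} :
    bitLabelling m x y c ↔ m.testBit (Nat.pair (Nat.pair x y) c) = true := by
  rw [Nat.testBit_eq_decide_div_mod_eq, decide_eq_true_iff, bitLabelling]

/-- Pairing is monotone, so triples below `s` have codes below `Nat.pair (Nat.pair s s) s`, and bit
strings of that length describe all restricted labellings. -/
theorem exists_bitLabelling (V : ℕ → ℕ → ℕ → Prop) (s : ℕ) :
    ∃ m < 2 ^ Nat.pair (Nat.pair s s) s, ∀ x < s, ∀ y < s, ∀ c < s,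
      (bitLabelling m x y c ↔ V x y c) := by
  classical
  refine ⟨Nat.ofBits fun j : Fin (Nat.pair (Nat.pair s s) s) =>
    decide (V (j : ℕ).unpair.1.unpair.1 (j : ℕ).unpair.1.unpair.2 (j : ℕ).unpair.2),
    Nat.ofBits_lt_two_pow _, fun x hx y hy c hc => ?_⟩
  have hlt : Nat.pair (Nat.pair x y) c < Nat.pair (Nat.pair s s) s :=
    ((Nat.pair_lt_pair_left _ ((Nat.pair_lt_pair_left _ hx).trans
      (Nat.pair_lt_pair_right _ hy))).trans (Nat.pair_lt_pair_right _ hc))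
  rw [bitLabelling_iff_testBit, Nat.testBit_ofBits_lt _ _ hlt]
  simp

/-- All nodes and labels that matter for the instance are below `s`. -/
def RuleInstance.Below (s : ℕ) (i : RuleInstance ℕ ℕ) : Prop :=
  (i.2.1.1 < s ∧ i.2.1.2.1 < s ∧ i.2.1.2.2 < s) ∧
  (i.2.2.1 < s ∧ i.2.2.2.1 < s ∧ i.2.2.2.2 < s) ∧
  natWit i.2.2.1 i.2.2.2.2 i.2.1.1 i.2.1.2.1 < s

theorem exists_below (L : List (RuleInstance ℕ ℕ)) : ∃ s, 2 ≤ s ∧ ∀ i ∈ L, i.Below s := by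
  induction L with
  | nil => exact ⟨2, le_rfl, by simp⟩
  | cons i L ih =>
    obtain ⟨s, h2, hs⟩ := ih
    refine ⟨s + i.2.1.1 + i.2.1.2.1 + i.2.1.2.2 + i.2.2.1 + i.2.2.2.1 + i.2.2.2.2 +
      natWit i.2.2.1 i.2.2.2.2 i.2.1.1 i.2.1.2.1 + 1, by omega, ?_⟩
    rw [List.forall_mem_cons]
    refine ⟨by simp only [RuleInstance.Below]; omega, fun j hj => ?_⟩
    have := hs j hj
    simp only [RuleInstance.Below] at this ⊢
    omega

theorem obeys_congr {s : ℕ} {V V' : ℕ → ℕ → ℕ → Prop}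
    (h : ∀ x < s, ∀ y < s, ∀ c < s, (V x y c ↔ V' x y c)) {i : RuleInstance ℕ ℕ}
    (hi : i.Below s) : Obeys natWit V i ↔ Obeys natWit V' i := by
  obtain ⟨o, ⟨a, b, c⟩, x, y, z⟩ := i
  obtain ⟨⟨ha, hb, hc⟩, ⟨hx, hy, hz⟩, hw⟩ := hi
  simp only at ha hb hc hx hy hz hw
  cases o
  · simp only [Obeys, h x hx y hy _ ha, h x hx y hy _ hb, h x hx y hy _ hc]
  · simp only [Obeys, h x hx y hy _ ha, h y hy z hz _ hb, h x hx z hz _ hc,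
      h x hx _ hw _ ha, h _ hw z hz _ hb]

/-- Propositional verification of `Identifies`, with a bound for the relevant nodes and labels. -/
def Verifies (s : ℕ) (L : List (RuleInstance ℕ ℕ)) : Prop :=
  (2 ≤ s ∧ ∀ i ∈ L, i.Below s) ∧
  ∀ m < 2 ^ Nat.pair (Nat.pair s s) s,
    ¬ (∀ i ∈ L, Obeys natWit (bitLabelling m) i) ∨
      (bitLabelling m 0 1 0 ∧ bitLabelling m 0 1 1) ∨
      ¬ (bitLabelling m 0 1 0 ∨ bitLabelling m 0 1 1)

/-- Obedience to a finite list depends only on values below some bound `s`, so a truth table decides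
it. The bound is part of the certificate and is found by search. -/
theorem identifies_iff_exists_verifies {L : List (RuleInstance ℕ ℕ)} :
    Identifies L ↔ ∃ s, Verifies s L := by
  constructor
  · intro h
    obtain ⟨s, h2, hs⟩ := exists_below L
    refine ⟨s, ⟨h2, hs⟩, fun m _ => ?_⟩
    have := h (bitLabelling m)
    tauto
  · rintro ⟨s, ⟨h2, hs⟩, h⟩ V hV
    obtain ⟨m, hm, hmV⟩ := exists_bitLabelling V s
    have h0 := hmV 0 (by omega) 1 (by omega) 0 (by omega)
    have h1 := hmV 0 (by omega) 1 (by omega) 1 (by omega)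
    have hob : ∀ i ∈ L, Obeys natWit (bitLabelling m) i := fun i hi =>
      (obeys_congr hmV (hs i hi)).2 (hV i hi)
    have := h m hm
    tauto

theorem primrecPred_bitLabelling {α : Type} [Primcodable α] {m x y c : α → ℕ} (hm : Primrec m)
    (hx : Primrec x) (hy : Primrec y) (hc : Primrec c) :
    PrimrecPred fun a => bitLabelling (m a) (x a) (y a) (c a) :=
  Primrec.eq.comp
    (Primrec.nat_mod.comp
      (Primrec.nat_div.comp hm
        (primrec_pow.comp (Primrec.const 2)
          (Primrec₂.natPair.comp (Primrec₂.natPair.comp hx hy) hc)))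
      (Primrec.const 2))
    (Primrec.const 1)

theorem primrec_natWit {α : Type} [Primcodable α] {x y a b : α → ℕ} (hx : Primrec x)
    (hy : Primrec y) (ha : Primrec a) (hb : Primrec b) :
    Primrec fun t => natWit (x t) (y t) (a t) (b t) :=
  Primrec.nat_add.comp
    (Primrec₂.natPair.comp (Primrec₂.natPair.comp hx hy) (Primrec₂.natPair.comp ha hb))
    (Primrec.const 2)

section Projections

open Primrec

theorem primrec_op : Primrec fun i : RuleInstance ℕ ℕ => i.1 := fst
theorem primrec_labels : Primrec fun i : RuleInstance ℕ ℕ => i.2.1 := fst.comp snd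
theorem primrec_nodes : Primrec fun i : RuleInstance ℕ ℕ => i.2.2 := snd.comp snd
theorem primrec_label₁ : Primrec fun i : RuleInstance ℕ ℕ => i.2.1.1 := fst.comp primrec_labels
theorem primrec_label₂ : Primrec fun i : RuleInstance ℕ ℕ => i.2.1.2.1 :=
  fst.comp (snd.comp primrec_labels)
theorem primrec_label₃ : Primrec fun i : RuleInstance ℕ ℕ => i.2.1.2.2 :=
  snd.comp (snd.comp primrec_labels)
theorem primrec_node₁ : Primrec fun i : RuleInstance ℕ ℕ => i.2.2.1 := fst.comp primrec_nodes
theorem primrec_node₂ : Primrec fun i : RuleInstance ℕ ℕ => i.2.2.2.1 :=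
  fst.comp (snd.comp primrec_nodes)
theorem primrec_node₃ : Primrec fun i : RuleInstance ℕ ℕ => i.2.2.2.2 :=
  snd.comp (snd.comp primrec_nodes)

theorem primrecRel_below : PrimrecRel fun (i : RuleInstance ℕ ℕ) (s : ℕ) => i.Below s := by
  have lt : ∀ {f : RuleInstance ℕ ℕ → ℕ}, Primrec f →
      PrimrecPred fun p : RuleInstance ℕ ℕ × ℕ => f p.1 < p.2 :=
    fun hf => nat_lt.comp (hf.comp fst) snd
  exact ((lt primrec_label₁).and ((lt primrec_label₂).and (lt primrec_label₃))).and
    (((lt primrec_node₁).and ((lt primrec_node₂).and (lt primrec_node₃))).and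
      (lt (primrec_natWit primrec_node₁ primrec_node₃ primrec_label₁ primrec_label₂)))

/-- A form with projections and only negation, conjunction and disjunction, the connectives under
which primitive recursive predicates are combined below. -/
theorem obeys_iff {N A : Type u} (wit : N → N → A → A → N) (V : N → N → A → Prop)
    (i : RuleInstance N A) : Obeys wit V i ↔
      (i.1 = true ∧
        (¬ V i.2.2.1 i.2.2.2.1 i.2.1.1 ∨ ¬ V i.2.2.2.1 i.2.2.2.2 i.2.1.2.1 ∨
          V i.2.2.1 i.2.2.2.2 i.2.1.2.2) ∧
        (¬ V i.2.2.1 i.2.2.2.2 i.2.1.2.2 ∨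
          (V i.2.2.1 (wit i.2.2.1 i.2.2.2.2 i.2.1.1 i.2.1.2.1) i.2.1.1 ∧
            V (wit i.2.2.1 i.2.2.2.2 i.2.1.1 i.2.1.2.1) i.2.2.2.2 i.2.1.2.1))) ∨
      (i.1 = false ∧
        ((V i.2.2.1 i.2.2.2.1 i.2.1.2.2 ∧
          (V i.2.2.1 i.2.2.2.1 i.2.1.1 ∨ V i.2.2.1 i.2.2.2.1 i.2.1.2.1)) ∨
        ¬ (V i.2.2.1 i.2.2.2.1 i.2.1.2.2 ∨
          (V i.2.2.1 i.2.2.2.1 i.2.1.1 ∨ V i.2.2.1 i.2.2.2.1 i.2.1.2.1)))) := by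
  obtain ⟨o, ⟨a, b, c⟩, x, y, z⟩ := i
  cases o
  · simp only [Obeys, Bool.false_eq_true, false_and, false_or, true_and]
    tauto
  · simp only [Obeys, Bool.true_eq_false, false_and, or_false, true_and]
    tauto

theorem primrecRel_obeys :
    PrimrecRel fun (i : RuleInstance ℕ ℕ) (m : ℕ) => Obeys natWit (bitLabelling m) i := by
  have bit : ∀ {x y c : RuleInstance ℕ ℕ → ℕ}, Primrec x → Primrec y → Primrec c →
      PrimrecPred fun p : RuleInstance ℕ ℕ × ℕ =>
        bitLabelling p.2 (x p.1) (y p.1) (c p.1) := fun hx hy hc =>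
    primrecPred_bitLabelling snd (hx.comp fst) (hy.comp fst) (hc.comp fst)
  have op : ∀ o : Bool, PrimrecPred fun p : RuleInstance ℕ ℕ × ℕ => p.1.1 = o := fun o =>
    Primrec.eq.comp (primrec_op.comp fst) (Primrec.const o)
  have hw := primrec_natWit primrec_node₁ primrec_node₃ primrec_label₁ primrec_label₂
  have hxc := bit primrec_node₁ primrec_node₃ primrec_label₃
  have hj := bit primrec_node₁ primrec_node₂ primrec_label₃
  have hj' := (bit primrec_node₁ primrec_node₂ primrec_label₁).or
    (bit primrec_node₁ primrec_node₂ primrec_label₂)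
  refine PrimrecPred.of_eq
    (((op true).and (((bit primrec_node₁ primrec_node₂ primrec_label₁).not.or
      ((bit primrec_node₂ primrec_node₃ primrec_label₂).not.or hxc)).and
      (hxc.not.or ((bit primrec_node₁ hw primrec_label₁).and
        (bit hw primrec_node₃ primrec_label₂))))).or
    ((op false).and ((hj.and hj').or (hj.or hj').not))) fun p => ?_
  exact (obeys_iff natWit (bitLabelling p.2) p.1).symm

theorem primrecRel_verifies : PrimrecRel Verifies := by
  have h1 : PrimrecPred fun p : ℕ × List (RuleInstance ℕ ℕ) => 2 ≤ p.1 ∧ ∀ i ∈ p.2, i.Below p.1 :=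
    (nat_le.comp (Primrec.const 2) fst).and (primrecRel_below.forall_mem_list.comp snd fst)
  have bit : ∀ c, PrimrecPred fun q : ℕ × List (RuleInstance ℕ ℕ) => bitLabelling q.1 0 1 c :=
    fun c => primrecPred_bitLabelling fst (Primrec.const 0) (Primrec.const 1) (Primrec.const c)
  have h2 : PrimrecRel fun (m : ℕ) (L : List (RuleInstance ℕ ℕ)) =>
      ¬ (∀ i ∈ L, Obeys natWit (bitLabelling m) i) ∨
      (bitLabelling m 0 1 0 ∧ bitLabelling m 0 1 1) ∨
      ¬ (bitLabelling m 0 1 0 ∨ bitLabelling m 0 1 1) :=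
    (primrecRel_obeys.forall_mem_list.comp snd fst).not.or
      (((bit 0).and (bit 1)).or ((bit 0).or (bit 1)).not)
  have hb : Primrec fun p : ℕ × List (RuleInstance ℕ ℕ) =>
      2 ^ Nat.pair (Nat.pair p.1 p.1) p.1 :=
    primrec_pow.comp (Primrec.const 2)
      (Primrec₂.natPair.comp (Primrec₂.natPair.comp fst fst) fst)
  have h3 := h2.forall_mem_list.comp (list_range.comp hb) snd
  exact h1.and (h3.of_eq fun p => by simp only [List.mem_range])

/-- The Gödel number of the equation of an instance. -/
def equationCode (k : ℕ) (i : RuleInstance ℕ ℕ) : ℕ :=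
  3 * Nat.pair (3 * Nat.pair (3 * (i.2.1.1 % (k + 2))) (3 * (i.2.1.2.1 % (k + 2))) +
    (if i.1 = true then 1 else 2)) (3 * (i.2.1.2.2 % (k + 2))) + 1

/-- The Gödel number of an identification sentence. -/
def identificationCode (k : ℕ) (L : List (RuleInstance ℕ ℕ)) : ℕ :=
  (fun n => 3 * n + 3)^[k + 2]
    (L.foldr (fun i n => 3 * Nat.pair (equationCode k i) n + 2)
      (3 * Nat.pair (3 * (0 % (k + 2))) (3 * (1 % (k + 2))) + 1))

theorem formulaCode_alls {n : ℕ} (φ : Fm n) :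
    formulaCode (k := 0) φ.alls = (fun c => 3 * c + 3)^[n] (formulaCode φ) := by
  induction n with
  | zero => rfl
  | succ n ih =>
    rw [Function.iterate_succ_apply]
    exact ih φ.all

theorem formulaCode_equation (k : ℕ) (i : RuleInstance ℕ ℕ) :
    formulaCode (i.equation k) = equationCode k i := by
  obtain ⟨o, ⟨a, b, c⟩, x, y, z⟩ := i
  cases o <;> rfl

theorem formulaCode_identification (k : ℕ) (L : List (RuleInstance ℕ ℕ)) :
    formulaCode (k := 0) (identification k L) = identificationCode k L := by
  rw [identification, formulaCode_alls, identificationCode]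
  congr 1
  induction L with
  | nil => rfl
  | cons i L ih =>
    rw [List.foldr_cons, ← ih, ← formulaCode_equation]
    rfl

theorem primrec_identificationCode : Primrec₂ identificationCode := by
  have triple : ∀ {α : Type} [Primcodable α] {f : α → ℕ} (c : ℕ), Primrec f →
      Primrec fun a => 3 * f a + c := fun c hf =>
    nat_add.comp (nat_mul.comp (Primrec.const 3) hf) (Primrec.const c)
  have v : ∀ {α : Type} [Primcodable α] {f g : α → ℕ}, Primrec f → Primrec g →
      Primrec fun a => 3 * (g a % (f a + 2)) := fun hf hg =>
    nat_mul.comp (Primrec.const 3) (nat_mod.comp hg (nat_add.comp hf (Primrec.const 2)))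
  have heq : Primrec₂ equationCode := by
    refine triple 1 (Primrec₂.natPair.comp (nat_add.comp (nat_mul.comp (Primrec.const 3)
      (Primrec₂.natPair.comp (v fst (primrec_label₁.comp snd))
        (v fst (primrec_label₂.comp snd)))) ?_)
      (v fst (primrec_label₃.comp snd)))
    exact Primrec.ite (Primrec.eq.comp (primrec_op.comp snd) (Primrec.const true))
      (Primrec.const 1) (Primrec.const 2)
  refine nat_iterate (nat_add.comp fst (Primrec.const 2))
    (list_foldr (h := fun (p : ℕ × List (RuleInstance ℕ ℕ)) (q : RuleInstance ℕ ℕ × ℕ) =>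
      3 * Nat.pair (equationCode p.1 q.1) q.2 + 2) snd ?_ ?_) ?_
  · exact triple 1 (Primrec₂.natPair.comp (v fst (Primrec.const 0)) (v fst (Primrec.const 1)))
  · exact triple 2 (Primrec₂.natPair.comp (heq.comp (fst.comp fst) (fst.comp snd))
      (snd.comp snd))
  · exact triple 3 snd

/-- A certificate for the code of an axiom consists of the bound `s`, the parameter `k` and the list
`L`; checking it is primitive recursive. -/
theorem recursivelyEnumerable_representabilityTheory :
    RecursivelyEnumerable representabilityTheory := by
  have hp : PrimrecRel fun (c : ℕ) (q : ℕ × ℕ × List (RuleInstance ℕ ℕ)) =>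
      Verifies q.1 q.2.2 ∧ identificationCode q.2.1 q.2.2 = c :=
    (primrecRel_verifies.comp (fst.comp snd) (snd.comp (snd.comp snd))).and
      (Primrec.eq.comp (primrec_identificationCode.comp (fst.comp (snd.comp snd))
        (snd.comp (snd.comp snd))) fst)
  refine (rePred_exists_of_primrecRel hp).of_eq fun c => ?_
  constructor
  · rintro ⟨⟨s, k, L⟩, hs, hc⟩
    exact ⟨_, ⟨k, L, identifies_iff_exists_verifies.2 ⟨s, hs⟩, rfl⟩,
      (formulaCode_identification k L).trans hc⟩
  · rintro ⟨_, ⟨k, L, hL, rfl⟩, hc⟩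
    obtain ⟨s, hs⟩ := identifies_iff_exists_verifies.1 hL
    exact ⟨(s, k, L), hs, (formulaCode_identification k L).symm.trans hc⟩

end Projections

/-! ### Pseudo-universality -/

/-- The relation symbol that relates an element of the algebra to two points. -/
inductive RepRel : List Srt → Type
  | rep : RepRel [Srt.a, Srt.r, Srt.r]

/-- The two-sorted language with one further symbol, for the representation. -/
def repLang : TwoSorted sig := ⟨fun _ _ => Empty, RepRel⟩

namespace repLang

open TwoSorted

variable {p q : ℕ}

/-- The arguments of the relation symbol. -/
def args {T : Srt → Type u} (t : T Srt.a) (x y : T Srt.r) :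
    ∀ i : Fin [Srt.a, Srt.r, Srt.r].length, T ([Srt.a, Srt.r, Srt.r].get i)
  | ⟨0, _⟩ => t
  | ⟨1, _⟩ => x
  | ⟨2, _⟩ => y

/-- The atomic formula saying that `t` relates `x` to `y`. -/
def holds (t : Trm repLang p q Srt.a) (x y : Trm repLang p q Srt.r) : Fml repLang p q :=
  Fml.rel RepRel.rep (args t x y)

/-- The application of a binary function symbol of the algebra. -/
def binary (f : Func 2) (s t : Trm repLang p q Srt.a) : Trm repLang p q Srt.a :=
  Trm.base (L := sig) f ![s, t]

theorem isAtomic_holds (t : Trm repLang p q Srt.a) (x y : Trm repLang p q Srt.r) :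
    (holds t x y).IsAtomic := Fml.IsAtomic.rel _ _

variable {M D : Type u} (I : Interp repLang M D)

/-- The relation that interprets an element. -/
def relOf (c : M) : SetRel D D := {e | I.rel RepRel.rep (args (T := Carrier M D) c e.1 e.2)}

/-- The interpretation given by a family of relations. -/
def interpOf (R : M → SetRel D D) : Interp repLang M D where
  fn f := f.elim
  rel r := match r with
    | .rep => fun xs => (xs 1, xs 2) ∈ R (xs 0)

theorem relOf_interpOf (R : M → SetRel D D) : relOf (interpOf R) = R := rfl

variable [sig.Structure M] (va : Fin p → M) (vr : Fin q → D)

theorem realize_holds (t : Trm repLang p q Srt.a) (x y : Trm repLang p q Srt.r) :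
    (holds t x y).Realize I va vr ↔
      (x.realize I va vr, y.realize I va vr) ∈ relOf I (t.realize I va vr) := by
  refine Iff.of_eq (congrArg (I.rel RepRel.rep) (funext fun i => ?_))
  match i with
  | ⟨0, _⟩ => rfl
  | ⟨1, _⟩ => rfl
  | ⟨2, _⟩ => rfl

theorem realize_comp (s t : Trm repLang p q Srt.a) :
    (binary Func.comp s t).realize I va vr =
      compOp (s.realize I va vr : M) (t.realize I va vr : M) := by
  refine congrArg _ (funext fun i => ?_)
  fin_cases i <;> rfl

theorem realize_join (s t : Trm repLang p q Srt.a) :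
    (binary Func.join s t).realize I va vr =
      joinOp (s.realize I va vr : M) (t.realize I va vr : M) := by
  refine congrArg _ (funext fun i => ?_)
  fin_cases i <;> rfl

/-- Distinct elements are interpreted by distinct relations. -/
def injectiveAxiom : Fml repLang 0 0 :=
  .allA <| .allA <| .or (.eq (.avar 0) (.avar 1)) <| .exR <| .exR <|
    .or (.and (holds (.avar 0) (.rvar 0) (.rvar 1)) (.neg (holds (.avar 1) (.rvar 0) (.rvar 1))))
      (.and (holds (.avar 1) (.rvar 0) (.rvar 1)) (.neg (holds (.avar 0) (.rvar 0) (.rvar 1))))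

/-- The join is interpreted by union. -/
def joinAxiom : Fml repLang 0 0 :=
  .allA <| .allA <| .allR <| .allR <|
    .or (.and (holds (binary Func.join (.avar 0) (.avar 1)) (.rvar 0) (.rvar 1))
          (.or (holds (.avar 0) (.rvar 0) (.rvar 1)) (holds (.avar 1) (.rvar 0) (.rvar 1))))
      (.and (.neg (holds (binary Func.join (.avar 0) (.avar 1)) (.rvar 0) (.rvar 1)))
        (.and (.neg (holds (.avar 0) (.rvar 0) (.rvar 1)))
          (.neg (holds (.avar 1) (.rvar 0) (.rvar 1)))))

/-- The product contains the composition. -/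
def compAxiom : Fml repLang 0 0 :=
  .allA <| .allA <| .allR <| .allR <| .allR <|
    .or (.neg (holds (.avar 0) (.rvar 0) (.rvar 1))) <|
    .or (.neg (holds (.avar 1) (.rvar 1) (.rvar 2)))
      (holds (binary Func.comp (.avar 0) (.avar 1)) (.rvar 0) (.rvar 2))

/-- The product is contained in the composition. -/
def witnessAxiom : Fml repLang 0 0 :=
  .allA <| .allA <| .allR <| .allR <|
    .or (.neg (holds (binary Func.comp (.avar 0) (.avar 1)) (.rvar 0) (.rvar 1))) <| .exR <|
    .and (holds (.avar 0) (.rvar 0) (.rvar 2)) (holds (.avar 1) (.rvar 2) (.rvar 1))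

/-- The two-sorted theory of representations. -/
def axioms : Set (Fml repLang 0 0) := {injectiveAxiom, joinAxiom, compAxiom, witnessAxiom}

theorem isPseudoUniversal_of_mem_axioms {φ : Fml repLang 0 0} (h : φ ∈ axioms) :
    φ.IsPseudoUniversal := by
  have pos : ∀ {p q : ℕ} (t : Trm repLang p q Srt.a) (x y : Trm repLang p q Srt.r),
      (holds t x y).IsPseudoUniversal := fun t x y => .atom (isAtomic_holds t x y)
  have neg : ∀ {p q : ℕ} (t : Trm repLang p q Srt.a) (x y : Trm repLang p q Srt.r),
      (Fml.neg (holds t x y)).IsPseudoUniversal := fun t x y => .negAtom (isAtomic_holds t x y)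
  rcases h with rfl | rfl | rfl | rfl
  · exact .allA <| .allA <| .or (.atom (.eq _ _)) <| .exR <| .exR <|
      .or (.and (pos _ _ _) (neg _ _ _)) (.and (pos _ _ _) (neg _ _ _))
  · exact .allA <| .allA <| .allR <| .allR <| .or (.and (pos _ _ _) (.or (pos _ _ _) (pos _ _ _)))
      (.and (neg _ _ _) (.and (neg _ _ _) (neg _ _ _)))
  · exact .allA <| .allA <| .allR <| .allR <| .allR <| .or (neg _ _ _) <|
      .or (neg _ _ _) (pos _ _ _)
  · exact .allA <| .allA <| .allR <| .allR <| .or (neg _ _ _) <| .exR <|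
      .and (pos _ _ _) (pos _ _ _)

theorem realize_injectiveAxiom (v : Fin 0 → M) (w : Fin 0 → D) :
    injectiveAxiom.Realize I v w ↔ ∀ a b : M, a = b ∨ ∃ x y : D,
      ((x, y) ∈ relOf I a ∧ (x, y) ∉ relOf I b) ∨ ((x, y) ∈ relOf I b ∧ (x, y) ∉ relOf I a) := by
  simp only [injectiveAxiom, Fml.Realize, realize_holds]
  rfl

theorem realize_joinAxiom (v : Fin 0 → M) (w : Fin 0 → D) :
    joinAxiom.Realize I v w ↔ ∀ (a b : M) (x y : D),
      ((x, y) ∈ relOf I (joinOp a b) ∧ ((x, y) ∈ relOf I a ∨ (x, y) ∈ relOf I b)) ∨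
      ((x, y) ∉ relOf I (joinOp a b) ∧ (x, y) ∉ relOf I a ∧ (x, y) ∉ relOf I b) := by
  simp only [joinAxiom, Fml.Realize, realize_holds, realize_join]
  rfl

theorem realize_compAxiom (v : Fin 0 → M) (w : Fin 0 → D) :
    compAxiom.Realize I v w ↔ ∀ (a b : M) (x y z : D),
      (x, y) ∉ relOf I a ∨ (y, z) ∉ relOf I b ∨ (x, z) ∈ relOf I (compOp a b) := by
  simp only [compAxiom, Fml.Realize, realize_holds, realize_comp]
  rfl

theorem realize_witnessAxiom (v : Fin 0 → M) (w : Fin 0 → D) :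
    witnessAxiom.Realize I v w ↔ ∀ (a b : M) (x z : D),
      (x, z) ∉ relOf I (compOp a b) ∨ ∃ y, (x, y) ∈ relOf I a ∧ (y, z) ∈ relOf I b := by
  simp only [witnessAxiom, Fml.Realize, realize_holds, realize_comp]
  rfl

/-- The axioms are the clauses of a representation read pointwise, with equality of composition
split into two inclusions. Existential quantifiers appear only for separating points and for middle
points. -/
theorem realize_axioms_iff (v : Fin 0 → M) (w : Fin 0 → D) :
    (∀ φ ∈ axioms, φ.Realize I v w) ↔ IsRepresentation compOp joinOp (relOf I) := by
  simp only [axioms, Set.mem_insert_iff, Set.mem_singleton_iff, forall_eq_or_imp, forall_eq,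
    realize_injectiveAxiom, realize_joinAxiom, realize_compAxiom, realize_witnessAxiom]
  constructor
  · rintro ⟨hi, hj, hc, hw⟩
    refine ⟨fun a b h => ?_, fun a b => Set.ext fun ⟨x, y⟩ => ?_, fun a b =>
      Set.ext fun ⟨x, z⟩ => ⟨fun h => ?_, ?_⟩⟩
    · have := hi a b
      rw [h] at this
      simpa using this
    · have := hj a b x y
      rw [Set.mem_union]
      tauto
    · exact (hw a b x z).resolve_left (not_not_intro h)
    · rintro ⟨y, h1, h2⟩
      exact ((hc a b x y z).resolve_left (not_not_intro h1)).resolve_left (not_not_intro h2)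
  · intro h
    refine ⟨fun a b => ?_, fun a b x y => ?_, fun a b x y z => ?_, fun a b x z => ?_⟩
    · by_contra hno
      push Not at hno
      exact hno.1 (h.injective (Set.ext fun ⟨x, y⟩ => ⟨(hno.2 x y).1, (hno.2 x y).2⟩))
    · rw [h.map_join, Set.mem_union]
      tauto
    · rw [h.map_comp]
      by_cases h1 : (x, y) ∈ relOf I a
      · by_cases h2 : (y, z) ∈ relOf I b
        · exact Or.inr (Or.inr ⟨y, h1, h2⟩)
        · exact Or.inr (Or.inl h2)
      · exact Or.inl h1
    · rw [h.map_comp]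
      exact (em _).symm

end repLang

theorem pseudoUniversal_rClass :
    PseudoUniversal.{u} sig (fun M _ => RClass M) := by
  refine ⟨repLang, repLang.axioms, fun _ => inferInstanceAs (IsEmpty Empty),
    fun φ h => repLang.isPseudoUniversal_of_mem_axioms h, fun M _ _ => ?_⟩
  constructor
  · rintro ⟨D, hD, R, hR⟩
    refine ⟨D, hD, repLang.interpOf R, (repLang.realize_axioms_iff _ _ _).2 ?_⟩
    rwa [repLang.relOf_interpOf]
  · rintro ⟨D, hD, I, h⟩
    exact ⟨D, hD, repLang.relOf I, (repLang.realize_axioms_iff _ _ _).1 h⟩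

end RelRep

theorem theorem5 :
    (∀ (A : Type u) [RelRep.JoinSemilatticeOrderedSemigroup A],
      (∀ n : ℕ, A ⊨ RelRep.rho n ↔ RelRep.HasWinningStrategy A n) ∧
      (RelRep.Representable A ↔ ∀ n : ℕ, A ⊨ RelRep.rho n)) ∧
    RelRep.PseudoUniversal.{u} RelRep.sig (fun M _ => RelRep.RClass M) ∧
    ∃ T : RelRep.sig.Theory,
      (∀ φ ∈ T, φ.IsUniversal) ∧
      RelRep.RecursivelyEnumerable T ∧
      ∀ (M : Type u) [RelRep.sig.Structure M], RelRep.RClass M ↔ M ⊨ T :=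
  ⟨fun _ _ => ⟨fun _ => RelRep.realize_rho_iff_hasWinningStrategy,
      RelRep.representable_iff_realize_rho⟩,
    RelRep.pseudoUniversal_rClass,
    RelRep.representabilityTheory,
    fun _ h => RelRep.isUniversal_of_mem_representabilityTheory h,
    RelRep.recursivelyEnumerable_representabilityTheory,
    fun _ _ => RelRep.rClass_iff_realize_representabilityTheory⟩
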